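/- A hypergraph $\mathcal H=(V,H)$ is a set $V$ of vertices with a collection $H$ of subsets of $V$, the hyperedges. Its theta complex $\Theta(\mathcal H)$ is the simplicial complex on $V$ whose simplices are the nonempty finite subsets of complements $V\setminus h$ of hyperedges $h\in H$; it is identified with its geometric realization. Let $\operatorname{Simp}(n,k)$ be the hypergraph whose vertices are the $n+1$ vertices of the $n$-simplex and whose hyperedges are the vertex sets of its $k$-dimensional faces. Let the $n$-dimensional cross-polytope be the iterated simplicial suspension $\Sigma^{n-1}S^0$, i.e. the simplicial complex on the $2n$ vertices $v_1^{\pm},\dots,v_n^{\pm}$ whose simplices are the nonempty vertex sets that contain no pair $\{v_i^+,v_i^-\}$, and let $\operatorname{CrossPoly}(n,k)$ be the hypergraph with the same vertices whose hyperedges are the vertex sets of its $k$-dimensional faces. **Theorem.** The following homotopy equivalences hold. 1. For all integers $0\le k\le n$, $$\Theta(\operatorname{Simp}(n,k))\simeq\bigvee_{\binom{n}{n-k}}S^{n-k-1},$$ where for $k=n$ (so that $\binom{n}{n-k}=1$) the right-hand side is read as $S^{-1}=\emptyset$; that is, $\Theta(\operatorname{Simp}(n,n))=\emptyset$. 2.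 For all integers $0\le k<n$, $$\Theta(\operatorname{CrossPoly}(n,k))\simeq\bigvee_{\binom{n-1}{k}}S^{2n-k-2}.$$ Here $\bigvee_m S^d$ is the wedge of $m$ copies of the $d$-sphere. -/

import Mathlib

open scoped ContinuousMap

noncomputable section

namespace ThetaComplex

/-! ### Simplicial complexes and hypergraphs -/

/-- The geometric realization of an abstract simplicial complex on a finite vertex type `V`: the
union, over the simplices `s`, of the convex hull of the standard basis vectors `e_v`, `v ∈ s`,
with the subspace topology from `V → ℝ`. -/
def realization {V : Type*} [Fintype V] (K : PreAbstractSimplicialComplex V) : Set (V → ℝ) :=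
  {x | x ∈ stdSimplex ℝ V ∧ ∃ s ∈ K, ∀ v, v ∉ s → x v = 0}

/-- The theta complex of a hypergraph `H`: its simplices are the nonempty finite subsets of
complements (in the vertex set) of hyperedges. -/
def theta {V : Type*} (H : Hypergraph V) : PreAbstractSimplicialComplex V where
  faces := {s | s.Nonempty ∧ ∃ e ∈ H.edgeSet, (s : Set V) ⊆ H.vertexSet \ e}
  isRelLowerSet_faces := by
    rintro s ⟨hs, e, he, hse⟩
    refine ⟨hs, fun t hts ht => ⟨ht, e, he, ?_⟩⟩
    exact (Finset.coe_subset.mpr hts).trans hse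

/-- The hypergraph of `k`-dimensional faces of a simplicial complex `K`: its vertices are the
vertices of `K`, its hyperedges are the vertex sets of the `k`-dimensional simplices of `K`. -/
def faceHypergraph {V : Type*} (K : PreAbstractSimplicialComplex V) (k : ℕ) : Hypergraph V where
  vertexSet := {v | {v} ∈ K}
  edgeSet := {e | ∃ s ∈ K, s.card = k + 1 ∧ (s : Set V) = e}
  subset_vertexSet_of_mem_edgeSet' := by
    rintro _ ⟨s, hs, -, rfl⟩ v hv
    exact (K.isRelLowerSet_faces hs).2 (Finset.singleton_subset_iff.mpr hv)
      (Finset.singleton_nonempty v)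

/-- `Simp(n,k)`: the hypergraph of `k`-faces of the `n`-simplex, the complex of all nonempty sets
of the `n + 1` vertices. -/
def Simp (n k : ℕ) : Hypergraph (Fin (n + 1)) :=
  faceHypergraph (⊤ : PreAbstractSimplicialComplex (Fin (n + 1))) k

/-- The (boundary complex of the) `n`-dimensional cross-polytope, on the vertices
`v_i^+ = (i, true)` and `v_i^- = (i, false)`: a nonempty set of vertices is a simplex if and only
if it contains no antipodal pair `v_i^+, v_i^-`. See `crossPolytope_one` and
`mem_suspension_crossPolytope` for the description as the iterated suspension of `S^0`. -/
def crossPolytope (n : ℕ) : PreAbstractSimplicialComplex (Fin n × Bool) where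
  faces := {s | s.Nonempty ∧ ∀ i, ¬ ((i, true) ∈ s ∧ (i, false) ∈ s)}
  isRelLowerSet_faces := by
    rintro s ⟨hs, h⟩
    exact ⟨hs, fun t hts ht => ⟨ht, fun i hi => h i ⟨hts hi.1, hts hi.2⟩⟩⟩

/-- `CrossPoly(n,k)`: the hypergraph of `k`-faces of the `n`-dimensional cross-polytope. -/
def CrossPoly (n k : ℕ) : Hypergraph (Fin n × Bool) :=
  faceHypergraph (crossPolytope n) k

/-- The simplicial suspension: two new vertices, which are not joined to each other. -/
def suspension {V : Type*} (K : PreAbstractSimplicialComplex V) :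
    PreAbstractSimplicialComplex (V ⊕ Bool) where
  faces := {s | s.Nonempty ∧ ¬ (Sum.inr true ∈ s ∧ Sum.inr false ∈ s) ∧
    (s.toLeft = ∅ ∨ s.toLeft ∈ K)}
  isRelLowerSet_faces := by
    rintro s ⟨hs, h, hK⟩
    refine ⟨hs, fun t hts ht => ⟨ht, fun hi => h ⟨hts hi.1, hts hi.2⟩, ?_⟩⟩
    have hsub : t.toLeft ⊆ s.toLeft := Finset.toLeft_subset_toLeft hts
    rcases Finset.eq_empty_or_nonempty t.toLeft with h0 | h0
    · exact Or.inl h0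
    · rcases hK with hK | hK
      · rw [hK] at hsub
        exact Or.inl (Finset.subset_empty.mp hsub)
      · exact Or.inr ((K.isRelLowerSet_faces hK).2 hsub h0)

/-- The vertices of the suspension of the `n`-dimensional cross-polytope, named as those of the
`(n + 1)`-dimensional one. -/
def suspVertexEquiv (n : ℕ) : (Fin n × Bool) ⊕ Bool ≃ Fin (n + 1) × Bool where
  toFun := Sum.elim (fun p => (p.1.castSucc, p.2)) (fun b => (Fin.last n, b))
  invFun q := Fin.lastCases (motive := fun _ => (Fin n × Bool) ⊕ Bool)
    (Sum.inr q.2) (fun i => Sum.inl (i, q.2)) q.1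
  left_inv := by
    rintro (⟨i, b⟩ | b) <;> simp
  right_inv := by
    rintro ⟨i, b⟩
    refine Fin.lastCases ?_ (fun j => ?_) i <;> simp

/-- The `1`-dimensional cross-polytope is `S^0`: two vertices and no other simplices. -/
theorem crossPolytope_one (s : Finset (Fin 1 × Bool)) :
    s ∈ crossPolytope 1 ↔ ∃ b, s = {(0, b)} := by
  change (s.Nonempty ∧ ∀ i, ¬ ((i, true) ∈ s ∧ (i, false) ∈ s)) ↔ _
  revert s
  decide

/-- The `(n + 1)`-dimensional cross-polytope is the suspension of the `n`-dimensional one. -/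
theorem mem_suspension_crossPolytope (n : ℕ) (s : Finset ((Fin n × Bool) ⊕ Bool)) :
    s ∈ suspension (crossPolytope n) ↔
      s.map (suspVertexEquiv n).toEmbedding ∈ crossPolytope (n + 1) := by
  have key : ∀ v, suspVertexEquiv n v ∈ s.map (suspVertexEquiv n).toEmbedding ↔ v ∈ s :=
    fun v => Finset.mem_map' (suspVertexEquiv n).toEmbedding
  have hl : ∀ b, ((Fin.last n, b) ∈ s.map (suspVertexEquiv n).toEmbedding ↔ Sum.inr b ∈ s) :=
    fun b => key (Sum.inr b)
  have hc : ∀ i b, ((Fin.castSucc i, b) ∈ s.map (suspVertexEquiv n).toEmbedding ↔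
      Sum.inl (i, b) ∈ s) := fun i b => key (Sum.inl (i, b))
  change (s.Nonempty ∧ ¬ (Sum.inr true ∈ s ∧ Sum.inr false ∈ s) ∧
      (s.toLeft = ∅ ∨ (s.toLeft.Nonempty ∧
        ∀ i, ¬ ((i, true) ∈ s.toLeft ∧ (i, false) ∈ s.toLeft)))) ↔
    ((s.map (suspVertexEquiv n).toEmbedding).Nonempty ∧
      ∀ i, ¬ ((i, true) ∈ s.map (suspVertexEquiv n).toEmbedding ∧
        (i, false) ∈ s.map (suspVertexEquiv n).toEmbedding))
  rw [Finset.map_nonempty, Fin.forall_fin_succ']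
  simp only [hl, hc, Finset.mem_toLeft]
  constructor
  · rintro ⟨h1, h2, h3⟩
    refine ⟨h1, fun i hi => ?_, h2⟩
    rcases h3 with h3 | h3
    · have := Finset.mem_toLeft.mpr hi.1
      rw [h3] at this
      simp at this
    · exact h3.2 i hi
  · rintro ⟨h1, h2, h3⟩
    refine ⟨h1, h3, ?_⟩
    rcases Finset.eq_empty_or_nonempty s.toLeft with h0 | h0
    · exact Or.inl h0
    · exact Or.inr ⟨h0, h2⟩

/-! ### Wedges of spheres -/

/-- The identifications in a wedge: each base point is glued to one extra point. (The extra point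
makes the empty wedge a one-point space.) -/
inductive WedgeRel {ι : Type*} {X : ι → Type*} (x₀ : ∀ i, X i) :
    Unit ⊕ (Σ i, X i) → Unit ⊕ (Σ i, X i) → Prop
  | glue (i : ι) : WedgeRel x₀ (Sum.inl ()) (Sum.inr ⟨i, x₀ i⟩)

/-- The wedge sum of the pointed spaces `(X i, x₀ i)`, with the quotient topology. -/
def Wedge {ι : Type*} {X : ι → Type*} (x₀ : ∀ i, X i) : Type _ :=
  Quot (WedgeRel x₀)

instance {ι : Type*} {X : ι → Type*} [∀ i, TopologicalSpace (X i)] (x₀ : ∀ i, X i) :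
    TopologicalSpace (Wedge x₀) :=
  inferInstanceAs (TopologicalSpace (Quot (WedgeRel x₀)))

/-- The sphere `S^d`, as the unit sphere of `ℝ^{d+1}`. -/
abbrev Sphere (d : ℕ) : Type :=
  Metric.sphere (0 : EuclideanSpace ℝ (Fin (d + 1))) 1

/-- The base point `(1, 0, …, 0)` of `S^d`. -/
def Sphere.base (d : ℕ) : Sphere d :=
  ⟨EuclideanSpace.single 0 1, by simp⟩

/-- The wedge `⋁_m S^d` of `m` copies of the `d`-sphere. -/
abbrev WedgeOfSpheres (m d : ℕ) : Type :=
  Wedge (fun _ : Fin m => Sphere.base d)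

end ThetaComplex

end

open scoped ContinuousMap

noncomputable section

namespace ThetaComplex

/-! ### Points of the realization -/

/-! Both theta complexes have a purely combinatorial description. In `Simp n k` a nonempty set
avoids some `k`-face iff it has at most `n - k` vertices, so the theta complex is the `(n - k -
1)`-skeleton of the `n`-simplex (`mem_theta_Simp`). In `CrossPoly n k` a set avoids some `k`-face
iff it contains at most `n - k - 1` antipodal pairs (`mem_theta_CrossPoly`).

In each case there is a contractible subcomplex `A` such that all simplices of `K` outside `A` have
the same dimension `d`. Their boundaries then lie in `A`, and `K ≃ K/A` is a wedge of `d`-spheres,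
one for each such simplex (`nonempty_homotopyEquiv_wedgeOfSpheres`). It remains to find `A` and to
count.

For the simplex, `A` is the star of the vertex `0`, a cone. What is left are the `(n - k)`-element
sets avoiding `0`.

For the cross-polytope, written with `n + 1` in place of `n`, `A` comes from an acyclic matching. A
simplex missing some `v_i^-` is matched by adding or removing `v_i^+` for the first such `i`, which
changes no antipodal pair. A simplex containing all `v_i^-` is matched by adding or removing
`v_0^+`, unless this would create one pair too many. The unmatched (critical) simplices consist of
all `v_i^-` and the `v_i^+` with `i` in an `(n - k)`-element set avoiding `0`. There are `n.choose
k` of them, each with `(n + 1) + (n - k)` vertices. The matching is carried out as collapses by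
`contractibleSpace_of_toggle`.

The equivalence `K ≃ K/A` is proved by hand: a contraction of `A` is extended explicitly to a
homotopy of `K` (`extendHomotopy`), and `K/A` is identified with the wedge by an explicit map from
the simplex to the sphere that pinches the boundary (`simplexToSphere`). -/

theorem mem_of_subset {V : Type*} {K : PreAbstractSimplicialComplex V} {s t : Finset V}
    (hs : s ∈ K) (hts : t ⊆ s) (ht : t.Nonempty) : t ∈ K :=
  (K.isRelLowerSet_faces hs).2 hts ht

theorem nonempty_of_mem {V : Type*} {K : PreAbstractSimplicialComplex V} {s : Finset V}
    (hs : s ∈ K) : s.Nonempty :=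
  (K.isRelLowerSet_faces hs).1

section Realization

variable {V : Type*} [Fintype V] {K L : PreAbstractSimplicialComplex V}

open Classical in
/-- The set of vertices at which a point has a nonzero barycentric coordinate. -/
def carrier (x : V → ℝ) : Finset V := Finset.univ.filter (fun v => x v ≠ 0)

theorem mem_carrier {x : V → ℝ} {v : V} : v ∈ carrier x ↔ x v ≠ 0 := by
  simp [carrier]

theorem carrier_subset {x : V → ℝ} {s : Finset V} : carrier x ⊆ s ↔ ∀ v, v ∉ s → x v = 0 := by
  refine forall_congr' fun v => ?_
  rw [mem_carrier]
  tauto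

theorem carrier_nonempty {x : V → ℝ} (hx : x ∈ stdSimplex ℝ V) : (carrier x).Nonempty := by
  by_contra h
  rw [Finset.not_nonempty_iff_eq_empty] at h
  have h0 : ∀ v, x v = 0 := fun v => by
    by_contra hv
    simpa [h] using mem_carrier.2 hv
  have := hx.2
  simp [h0] at this

/-- The carrier is the smallest simplex that can witness membership, so downward closure replaces
the existential by one condition. -/
theorem mem_realization_iff {x : V → ℝ} :
    x ∈ realization K ↔ x ∈ stdSimplex ℝ V ∧ carrier x ∈ K := by
  constructor
  · rintro ⟨hx, s, hs, h⟩
    exact ⟨hx, mem_of_subset hs (carrier_subset.2 h) (carrier_nonempty hx)⟩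
  · rintro ⟨hx, h⟩
    exact ⟨hx, _, h, carrier_subset.1 subset_rfl⟩

theorem realization_mono (h : L ≤ K) : realization L ⊆ realization K :=
  fun _ ⟨hx, s, hs, h'⟩ => ⟨hx, s, h hs, h'⟩

theorem isClosed_realization (K : PreAbstractSimplicialComplex V) : IsClosed (realization K) := by
  have : realization K = ⋃ s ∈ (K : Set (Finset V)),
      (stdSimplex ℝ V ∩ ⋂ v ∈ {v | v ∉ s}, {x | x v = 0}) := by
    ext x
    simp only [realization, Set.mem_ofPred_eq, Set.mem_iUnion, Set.mem_inter_iff, Set.mem_iInter]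
    constructor
    · rintro ⟨hx, s, hs, h⟩
      exact ⟨s, hs, hx, h⟩
    · rintro ⟨s, hs, hx, h⟩
      exact ⟨hx, s, hs, h⟩
  rw [this]
  refine (Set.toFinite _).isClosed_biUnion fun s _ => (isClosed_stdSimplex ℝ V).inter ?_
  exact isClosed_biInter fun v _ => isClosed_eq (continuous_apply v) continuous_const

/-- Compactness makes the covering maps used later closed, hence quotient maps. -/
theorem isCompact_realization (K : PreAbstractSimplicialComplex V) : IsCompact (realization K) :=
  (isCompact_stdSimplex ℝ V).of_isClosed_subset (isClosed_realization K) fun _ hx => hx.1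

instance (K : PreAbstractSimplicialComplex V) : CompactSpace (realization K) :=
  isCompact_iff_compactSpace.mp (isCompact_realization K)

/-- A complex with a single vertex has a contractible realization. -/
theorem contractibleSpace_realization_of_singleton (v : V) (h : ∀ s, s ∈ K ↔ s = {v}) :
    ContractibleSpace (realization K) := by
  classical
  have hx : ∀ x ∈ realization K, x = Pi.single v 1 := by
    rintro x ⟨hx, s, hs, h0⟩
    rw [h] at hs
    subst hs
    have h1 : ∀ u, u ≠ v → x u = 0 := fun u hu => h0 u (by simpa using hu)
    have h2 := hx.2
    rw [Finset.sum_eq_single v (fun u _ hu => h1 u hu) (by simp)] at h2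
    ext u
    by_cases hu : u = v
    · subst hu; simp [h2]
    · simp [hu, h1 u hu]
  have : Unique (realization K) :=
    { default := ⟨Pi.single v 1, single_mem_stdSimplex ℝ v, {v}, (h _).2 rfl, fun u hu => by
        simp only [Finset.mem_singleton] at hu
        simp [hu]⟩
      uniq := fun x => Subtype.ext (hx x x.2) }
  infer_instance

/-! ### Collapses -/

/-- Pushing a simplex `t` away from its barycentre towards the vertex `v`. -/
def push [DecidableEq V] (t : Finset V) (ht : t.Nonempty) (v : V) (x : V → ℝ) : V → ℝ := fun u =>
  x u - (if u ∈ t then t.inf' ht x else 0) + (if u = v then t.card * t.inf' ht x else 0)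

theorem continuous_push {V : Type*} [DecidableEq V] (t : Finset V) (ht : t.Nonempty) (v : V) :
    Continuous (push t ht v) := by
  have hm : Continuous fun x : V → ℝ => t.inf' ht x :=
    Continuous.finset_inf'_apply ht fun i _ => continuous_apply i
  refine continuous_pi fun u => ?_
  unfold push
  refine ((continuous_apply u).sub ?_).add ?_
  · split_ifs
    · exact hm
    · exact continuous_const
  · split_ifs
    · exact continuous_const.mul hm
    · exact continuous_const

theorem inf'_nonneg {t : Finset V} (ht : t.Nonempty) {x : V → ℝ} (hx : x ∈ stdSimplex ℝ V) :
    0 ≤ t.inf' ht x :=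
  Finset.le_inf' _ _ fun v _ => hx.1 v

theorem inf'_eq_zero {t : Finset V} (ht : t.Nonempty) {x : V → ℝ} (hx : x ∈ stdSimplex ℝ V)
    (h : ¬ t ⊆ carrier x) : t.inf' ht x = 0 := by
  obtain ⟨u, hu, hu'⟩ := Finset.not_subset.1 h
  rw [mem_carrier, not_not] at hu'
  exact le_antisymm (hu' ▸ Finset.inf'_le _ hu) (inf'_nonneg ht hx)

theorem push_mem_stdSimplex [DecidableEq V] {t : Finset V} (ht : t.Nonempty) {v : V}
    {x : V → ℝ} (hx : x ∈ stdSimplex ℝ V) : push t ht v x ∈ stdSimplex ℝ V := by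
  have h0 := inf'_nonneg ht hx
  constructor
  · intro u
    unfold push
    have h2 : 0 ≤ (if u = v then t.card * t.inf' ht x else 0) := by
      split_ifs
      · positivity
      · exact le_rfl
    split_ifs at h2 ⊢ with h <;> first
      | (have := Finset.inf'_le x h; linarith)
      | (have := hx.1 u; linarith)
  · unfold push
    rw [Finset.sum_add_distrib, Finset.sum_sub_distrib, hx.2]
    simp

theorem push_eq_self [DecidableEq V] {t : Finset V} (ht : t.Nonempty) {v : V}
    {x : V → ℝ} (hx : x ∈ stdSimplex ℝ V) (h : ¬ t ⊆ carrier x) : push t ht v x = x := by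
  ext u
  simp [push, inf'_eq_zero ht hx h]

/-- A vertex of `t` with the least coordinate drops to `0`, and the mass removed is put at `v`,
outside `t`. -/
theorem not_subset_carrier_push [DecidableEq V] {t : Finset V} (ht : t.Nonempty) {v : V}
    (hv : v ∉ t) (x : V → ℝ) : ¬ t ⊆ carrier (push t ht v x) := by
  obtain ⟨u, hu, hu'⟩ := Finset.exists_mem_eq_inf' ht x
  intro h
  have := mem_carrier.1 (h hu)
  have huv : u ≠ v := fun h => hv (h ▸ hu)
  simp [push, hu, huv, hu'] at this

theorem carrier_push_subset [DecidableEq V] {t s : Finset V} (ht : t.Nonempty) {v : V}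
    {x : V → ℝ} (hts : t ⊆ s) (hv : v ∈ s) (hx : carrier x ⊆ s) :
    carrier (push t ht v x) ⊆ s := by
  rw [carrier_subset] at hx ⊢
  intro u hu
  have h1 : u ∉ t := fun h => hu (hts h)
  have h2 : u ≠ v := fun h => hu (h ▸ hv)
  simp [push, h1, h2, hx u hu]

/-- The straight line between two points of a common simplex. -/
theorem lineMap_mem_realization {s : Finset V} (hs : s ∈ K) {x y : V → ℝ}
    (hx : x ∈ stdSimplex ℝ V) (hy : y ∈ stdSimplex ℝ V) (hxs : carrier x ⊆ s) (hys : carrier y ⊆ s)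
    (τ : unitInterval) : (1 - (τ : ℝ)) • x + (τ : ℝ) • y ∈ realization K := by
  refine ⟨convex_stdSimplex ℝ V hx hy (by linarith [τ.2.2]) τ.2.1 (by ring), s, hs, fun v hv => ?_⟩
  simp [carrier_subset.1 hxs v hv, carrier_subset.1 hys v hv]

/-- An elementary collapse preserves contractibility. -/
theorem contractibleSpace_of_elementaryCollapse [DecidableEq V] (hLK : L ≤ K) {t : Finset V}
    (ht : t.Nonempty) {v : V} (hv : v ∉ t) (htv : insert v t ∈ K)
    (hL : ∀ s ∈ K, s ∉ L ↔ t ⊆ s) (hmax : ∀ s ∈ K, t ⊆ s → s ⊆ insert v t)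
    [ContractibleSpace (realization L)] : ContractibleSpace (realization K) := by
  -- A point and its push share a simplex of `K`; hence the straight-line homotopy below stays in
  -- the realization.
  have hpush : ∀ x ∈ realization K, ∃ s ∈ K, carrier x ⊆ s ∧ carrier (push t ht v x) ⊆ s := by
    intro x hx
    rw [mem_realization_iff] at hx
    by_cases h : t ⊆ carrier x
    · have h1 := hmax _ hx.2 h
      exact ⟨_, htv, h1, carrier_push_subset ht (Finset.subset_insert _ _)
        (Finset.mem_insert_self _ _) h1⟩
    · exact ⟨_, hx.2, subset_rfl, by rw [push_eq_self ht hx.1 h]⟩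
  have hr : ∀ x ∈ realization K, push t ht v x ∈ realization L := by
    intro x hx
    obtain ⟨s, hs, -, h⟩ := hpush x hx
    have h1 : push t ht v x ∈ stdSimplex ℝ V := push_mem_stdSimplex ht hx.1
    have h2 := mem_of_subset hs h (carrier_nonempty h1)
    refine mem_realization_iff.2 ⟨h1, ?_⟩
    by_contra h3
    exact not_subset_carrier_push ht hv x ((hL _ h2).1 h3)
  let i : C(realization L, realization K) :=
    ⟨Set.inclusion (realization_mono hLK), continuous_inclusion _⟩
  let r : C(realization K, realization L) :=
    ⟨fun x => ⟨push t ht v x, hr x x.2⟩,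
      ((continuous_push t ht v).comp continuous_subtype_val).subtype_mk _⟩
  have hri : r.comp i = ContinuousMap.id _ := by
    ext1 x
    apply Subtype.ext
    have hx := mem_realization_iff.1 x.2
    exact push_eq_self ht hx.1 fun h => (hL _ (hLK hx.2)).2 h hx.2
  let F : (ContinuousMap.id (realization K)).Homotopy (i.comp r) :=
    { toFun := fun p => ⟨(1 - (p.1 : ℝ)) • (p.2 : V → ℝ) + (p.1 : ℝ) • push t ht v p.2, by
        obtain ⟨s, hs, h1, h2⟩ := hpush p.2 p.2.2
        exact lineMap_mem_realization hs p.2.2.1 (push_mem_stdSimplex ht p.2.2.1) h1 h2 p.1⟩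
      continuous_toFun := by
        have := continuous_push t ht v
        refine Continuous.subtype_mk ?_ _
        fun_prop
      map_zero_left := fun x => by apply Subtype.ext; simp
      map_one_left := fun x => by apply Subtype.ext; simp [i, r] }
  let e : realization K ≃ₕ realization L :=
    { toFun := r
      invFun := i
      left_inv := ⟨F.symm⟩
      right_inv := by rw [hri] }
  exact e.contractibleSpace

/-- If the simplices of `K` outside `L` are closed under adding and removing the vertex `v`, then
`K` collapses onto `L`. -/
theorem contractibleSpace_of_toggle [DecidableEq V] (hLK : L ≤ K) (v : V)
    (hins : ∀ s ∈ K, s ∉ L → insert v s ∈ K)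
    (hera : ∀ s ∈ K, s ∉ L → (s.erase v).Nonempty ∧ s.erase v ∉ L)
    [ContractibleSpace (realization L)] : ContractibleSpace (realization K) := by
  classical
  induction hn : ((Finset.univ : Finset (Finset V)).filter (fun s => s ∈ K ∧ s ∉ L)).card
    using Nat.strong_induction_on generalizing K with
  | _ n ih =>
    rcases Finset.eq_empty_or_nonempty
      ((Finset.univ : Finset (Finset V)).filter (fun s => s ∈ K ∧ s ∉ L)) with h0 | h0
    · have : K = L := le_antisymm (fun s hs => by
        by_contra h
        have : s ∈ ((Finset.univ : Finset (Finset V)).filter (fun s => s ∈ K ∧ s ∉ L)) := by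
          simp only [Finset.mem_filter, Finset.mem_univ, true_and]
          exact ⟨hs, h⟩
        simp [h0] at this) hLK
      rw [this]; infer_instance
    -- For `s` of largest size outside `L`, the set `t = s.erase v` is a free face: `t` and `insert
    -- v t` are the only simplices of `K` containing `t`. Removing both is an elementary collapse,
    -- and the hypotheses persist.
    · obtain ⟨s, hs, hmax⟩ := Finset.exists_max_image _ Finset.card h0
      simp only [Finset.mem_filter, Finset.mem_univ, true_and] at hs hmax
      set t := s.erase v with ht
      obtain ⟨htne, htL⟩ := hera s hs.1 hs.2
      have htK : t ∈ K := mem_of_subset hs.1 (Finset.erase_subset _ _) htne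
      have hvt : v ∉ t := Finset.notMem_erase _ _
      have htvK := hins t htK htL
      have up : ∀ a b : Finset V, a ⊆ b → a ∉ L → a.Nonempty → b ∉ L :=
        fun a b h1 h2 h3 h4 => h2 (mem_of_subset h4 h1 h3)
      have htvL : insert v t ∉ L := up t _ (Finset.subset_insert _ _) htL htne
      -- `insert v u` also lies outside `L`, so it is no larger than `s ⊆ insert v t`; as it
      -- contains `insert v t`, the two are equal.
      have hsup : ∀ u ∈ K, t ⊆ u → u ⊆ insert v t := by
        intro u hu htu
        have huL := up t u htu htL htne
        have h1 := hins u hu huL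
        have h2 := up u _ (Finset.subset_insert v u) huL (htne.mono htu)
        have h3 := hmax _ ⟨h1, h2⟩
        have h4 : s ⊆ insert v t := by
          intro w hw
          by_cases hwv : w = v
          · simp [hwv]
          · simp [ht, hw, hwv]
        have h5 : insert v t = insert v u :=
          Finset.eq_of_subset_of_card_le (Finset.insert_subset_insert _ htu)
            (h3.trans (Finset.card_le_card h4))
        rw [h5]
        exact Finset.subset_insert _ _
      let M : PreAbstractSimplicialComplex V :=
        { faces := {u | u ∈ K ∧ ¬ t ⊆ u}
          isRelLowerSet_faces := by
            rintro a ⟨ha, hta⟩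
            exact ⟨nonempty_of_mem ha, fun b hb hbn =>
              ⟨mem_of_subset ha hb hbn, fun h => hta (h.trans hb)⟩⟩ }
      have hM : ∀ u, u ∈ M ↔ u ∈ K ∧ ¬ t ⊆ u := fun u => Iff.rfl
      have hMK : M ≤ K := fun u hu => ((hM u).1 hu).1
      have hLM : L ≤ M := fun u hu =>
        (hM u).2 ⟨hLK hu, fun h => up t u h htL htne hu⟩
      have hcM : ContractibleSpace (realization M) := by
        refine ih _ ?_ hLM ?_ ?_ rfl
        · rw [← hn]
          refine Finset.card_lt_card (Finset.ssubset_iff_of_subset ?_ |>.2 ⟨t, ?_, ?_⟩)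
          · intro u
            simp only [Finset.mem_filter, Finset.mem_univ, true_and, hM]
            tauto
          · simp only [Finset.mem_filter, Finset.mem_univ, true_and]
            exact ⟨htK, htL⟩
          · simp [hM]
        · intro u hu huL
          rw [hM] at hu ⊢
          refine ⟨hins u hu.1 huL, fun h => hu.2 fun w hw => ?_⟩
          have := h hw
          rw [Finset.mem_insert] at this
          exact this.resolve_left fun hwv => hvt (hwv ▸ hw)
        · intro u hu huL
          exact hera u (hMK hu) huL
      refine contractibleSpace_of_elementaryCollapse hMK htne hvt htvK ?_ hsup
      intro u hu
      rw [hM]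
      tauto

end Realization

/-! ### The sphere as a quotient of the simplex -/

section SimplexToSphere

variable {d : ℕ}

/-- The least barycentric coordinate. -/
def minCoord (x : Fin (d + 1) → ℝ) : ℝ := Finset.univ.inf' Finset.univ_nonempty x

theorem continuous_minCoord : Continuous (minCoord (d := d)) :=
  Continuous.finset_inf'_apply _ fun i _ => continuous_apply i

theorem minCoord_le (x : Fin (d + 1) → ℝ) (i : Fin (d + 1)) : minCoord x ≤ x i :=
  Finset.inf'_le _ (Finset.mem_univ i)

theorem exists_eq_minCoord (x : Fin (d + 1) → ℝ) : ∃ i, x i = minCoord x := by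
  obtain ⟨i, -, hi⟩ := Finset.exists_mem_eq_inf' Finset.univ_nonempty x
  exact ⟨i, hi.symm⟩

theorem minCoord_mul_add {c : ℝ} (hc : 0 ≤ c) (b : ℝ) (x : Fin (d + 1) → ℝ) :
    minCoord (fun i => c * x i + b) = c * minCoord x + b := by
  obtain ⟨i, hi⟩ := exists_eq_minCoord x
  refine le_antisymm ?_ (Finset.le_inf' _ _ fun j _ => ?_)
  · rw [← hi]
    exact minCoord_le (fun i => c * x i + b) i
  · have := mul_le_mul_of_nonneg_left (minCoord_le x j) hc
    linarith

theorem minCoord_nonneg {x : Fin (d + 1) → ℝ} (hx : x ∈ stdSimplex ℝ (Fin (d + 1))) :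
    0 ≤ minCoord x :=
  Finset.le_inf' _ _ fun j _ => hx.1 j

/-- The squared norm of the vector of coordinate differences `x (j + 1) - x 0`. -/
def diffSq (x : Fin (d + 1) → ℝ) : ℝ := ∑ j : Fin d, (x j.succ - x 0) ^ 2

theorem diffSq_nonneg (x : Fin (d + 1) → ℝ) : 0 ≤ diffSq x :=
  Finset.sum_nonneg fun _ _ => sq_nonneg _

/-- If all differences vanish the coordinates are equal, and then a zero minimum contradicts total
mass one. -/
theorem diffSq_add_pos {x : Fin (d + 1) → ℝ} (hx : x ∈ stdSimplex ℝ (Fin (d + 1))) :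
    0 < diffSq x + minCoord x ^ 2 := by
  have h1 := diffSq_nonneg x
  have h2 := sq_nonneg (minCoord x)
  by_contra h
  have h3 : diffSq x = 0 := by linarith
  have h4 : minCoord x = 0 := by
    have : minCoord x ^ 2 = 0 := by linarith
    exact pow_eq_zero_iff two_ne_zero |>.1 this
  unfold diffSq at h3
  rw [Finset.sum_eq_zero_iff_of_nonneg fun _ _ => sq_nonneg _] at h3
  have h5 : ∀ i, x i = x 0 := by
    intro i
    refine Fin.cases rfl (fun j => ?_) i
    have := h3 j (Finset.mem_univ _)
    have := pow_eq_zero_iff two_ne_zero |>.1 this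
    linarith
  obtain ⟨i, hi⟩ := exists_eq_minCoord x
  have h6 : ∀ j, x j = 0 := fun j => by rw [h5 j, ← h5 i, hi, h4]
  have := hx.2
  simp [h6] at this

/-- The coordinates of the image of a point of the simplex in the sphere: inverse stereographic
projection, applied to the coordinate differences divided by the least coordinate. -/
def sphereCoord (x : Fin (d + 1) → ℝ) : Fin (d + 1) → ℝ :=
  Fin.cons ((diffSq x - minCoord x ^ 2) / (diffSq x + minCoord x ^ 2))
    (fun j => 2 * minCoord x * (x j.succ - x 0) / (diffSq x + minCoord x ^ 2))

@[simp] theorem sphereCoord_zero (x : Fin (d + 1) → ℝ) :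
    sphereCoord x 0 = (diffSq x - minCoord x ^ 2) / (diffSq x + minCoord x ^ 2) := rfl

@[simp] theorem sphereCoord_succ (x : Fin (d + 1) → ℝ) (j : Fin d) : sphereCoord x j.succ =
    2 * minCoord x * (x j.succ - x 0) / (diffSq x + minCoord x ^ 2) := rfl

theorem sum_sq_sphereCoord {x : Fin (d + 1) → ℝ} (hx : x ∈ stdSimplex ℝ (Fin (d + 1))) :
    ∑ i, sphereCoord x i ^ 2 = 1 := by
  have h := (diffSq_add_pos hx).ne'
  rw [Fin.sum_univ_succ]
  simp only [sphereCoord_zero, sphereCoord_succ, div_pow, mul_pow]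
  rw [← Finset.sum_div, ← Finset.mul_sum]
  change _ + 2 ^ 2 * minCoord x ^ 2 * diffSq x / _ = 1
  field_simp
  ring

/-- The map from the simplex to the sphere which collapses the boundary to the base point. -/
def simplexToSphere (d : ℕ) (x : stdSimplex ℝ (Fin (d + 1))) : Sphere d :=
  ⟨WithLp.toLp 2 (sphereCoord x.1), by
    rw [mem_sphere_zero_iff_norm, EuclideanSpace.norm_eq]
    simp [sum_sq_sphereCoord x.2]⟩

theorem simplexToSphere_apply (x : stdSimplex ℝ (Fin (d + 1))) (i : Fin (d + 1)) :
    (simplexToSphere d x).1 i = sphereCoord x.1 i := rfl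

theorem continuous_simplexToSphere : Continuous (simplexToSphere d) := by
  have hx : ∀ i, Continuous fun x : stdSimplex ℝ (Fin (d + 1)) => x.1 i := fun i =>
    (continuous_apply i).comp continuous_subtype_val
  have hm : Continuous fun x : stdSimplex ℝ (Fin (d + 1)) => minCoord x.1 :=
    continuous_minCoord.comp continuous_subtype_val
  have hN : Continuous fun x : stdSimplex ℝ (Fin (d + 1)) => diffSq x.1 := by
    exact continuous_finsetSum _ fun j _ => ((hx _).sub (hx _)).pow 2
  refine Continuous.subtype_mk ((PiLp.continuous_toLp 2 _).comp (continuous_pi fun i => ?_)) _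
  refine Fin.cases ?_ (fun j => ?_) i
  · exact (hN.sub (hm.pow 2)).div (hN.add (hm.pow 2)) fun x => (diffSq_add_pos x.2).ne'
  · refine Continuous.div ?_ (hN.add (hm.pow 2)) fun x => (diffSq_add_pos x.2).ne'
    exact (continuous_const.mul hm).mul ((hx _).sub (hx _))

theorem sphere_ext {s t : Sphere d} (h : ∀ i, s.1 i = t.1 i) : s = t :=
  Subtype.ext (by ext i; exact h i)

theorem base_zero : (Sphere.base d).1 0 = 1 := by
  simp [Sphere.base]

theorem base_succ (j : Fin d) : (Sphere.base d).1 j.succ = 0 := by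
  simp [Sphere.base]

theorem simplexToSphere_of_minCoord_eq_zero {x : stdSimplex ℝ (Fin (d + 1))}
    (h : minCoord x.1 = 0) : simplexToSphere d x = Sphere.base d := by
  have h0 := diffSq_add_pos x.2
  refine sphere_ext fun i => ?_
  rw [simplexToSphere_apply]
  refine Fin.cases ?_ (fun j => ?_) i
  · rw [base_zero, sphereCoord_zero]
    rw [h] at h0 ⊢
    simp only [ne_eq, OfNat.ofNat_ne_zero, not_false_eq_true, zero_pow, add_zero, sub_zero] at h0 ⊢
    exact div_self h0.ne'
  · rw [base_succ, sphereCoord_succ, h]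
    simp

theorem simplexToSphere_ne_base {x : stdSimplex ℝ (Fin (d + 1))}
    (h : minCoord x.1 ≠ 0) : simplexToSphere d x ≠ Sphere.base d := by
  intro heq
  have h1 := simplexToSphere_apply x 0
  rw [heq, base_zero, sphereCoord_zero, eq_div_iff (diffSq_add_pos x.2).ne'] at h1
  have : 0 < minCoord x.1 ^ 2 := by positivity
  linarith

/-- Away from the boundary, equal images have equal stereographic coordinates (differences divided
by the minimum). Hence `y` is an affine function of `x` with slope `b / a`; comparing minima removes
the constant, and comparing coordinate sums forces the slope to be `1`. -/
theorem simplexToSphere_inj {x y : stdSimplex ℝ (Fin (d + 1))}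
    (h : simplexToSphere d x = simplexToSphere d y) :
    x = y ∨ minCoord x.1 = 0 ∧ minCoord y.1 = 0 := by
  by_cases hx0 : minCoord x.1 = 0
  · right
    refine ⟨hx0, ?_⟩
    by_contra hy0
    exact simplexToSphere_ne_base hy0 (h ▸ simplexToSphere_of_minCoord_eq_zero hx0)
  by_cases hy0 : minCoord y.1 = 0
  · exact absurd (h.trans (simplexToSphere_of_minCoord_eq_zero hy0)) (simplexToSphere_ne_base hx0)
  left
  have hc : ∀ i, sphereCoord x.1 i = sphereCoord y.1 i := fun i => by
    rw [← simplexToSphere_apply, ← simplexToSphere_apply, h]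
  have hmx : 0 < minCoord x.1 := lt_of_le_of_ne (minCoord_nonneg x.2) (Ne.symm hx0)
  have hmy : 0 < minCoord y.1 := lt_of_le_of_ne (minCoord_nonneg y.2) (Ne.symm hy0)
  have hDx := diffSq_add_pos x.2
  have hDy := diffSq_add_pos y.2
  set a := minCoord x.1 with ha
  set b := minCoord y.1 with hb
  have h0 := hc 0
  rw [sphereCoord_zero, sphereCoord_zero, div_eq_div_iff hDx.ne' hDy.ne', ← ha, ← hb] at h0
  have h1 : diffSq x.1 * b ^ 2 = diffSq y.1 * a ^ 2 := by linarith
  have h2 : ∀ j : Fin d, a * (y.1 j.succ - y.1 0) = b * (x.1 j.succ - x.1 0) := by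
    intro j
    have h3 := hc j.succ
    rw [sphereCoord_succ, sphereCoord_succ, div_eq_div_iff hDx.ne' hDy.ne', ← ha, ← hb] at h3
    have h4 : (2 * a * (x.1 j.succ - x.1 0) * (diffSq y.1 + b ^ 2)) * a ^ 2 =
        2 * a * (x.1 j.succ - x.1 0) * (b ^ 2 * (diffSq x.1 + a ^ 2)) := by
      linear_combination (-2 * a * (x.1 j.succ - x.1 0)) * h1
    have h5 : (2 * a * b * (diffSq x.1 + a ^ 2)) *
        (a * (y.1 j.succ - y.1 0) - b * (x.1 j.succ - x.1 0)) = 0 := by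
      linear_combination h4 - a ^ 2 * h3
    have h6 : 2 * a * b * (diffSq x.1 + a ^ 2) ≠ 0 := by positivity
    have := (mul_eq_zero.1 h5).resolve_left h6
    linarith
  have h3 : ∀ i, y.1 i = b / a * x.1 i + (y.1 0 - b / a * x.1 0) := by
    intro i
    refine Fin.cases (by ring) (fun j => ?_) i
    have := h2 j
    field_simp
    linarith
  have h4 : b = b / a * a + (y.1 0 - b / a * x.1 0) := by
    have h5 := minCoord_mul_add (div_pos hmy hmx).le (y.1 0 - b / a * x.1 0) x.1
    rw [← ha] at h5
    rw [← h5, hb]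
    congr 1
    funext i
    exact h3 i
  have h5 : y.1 0 - b / a * x.1 0 = 0 := by
    rw [div_mul_cancel₀ b hmx.ne'] at h4
    linarith
  have h6 : ∀ i, y.1 i = b / a * x.1 i := fun i => by rw [h3 i, h5, add_zero]
  have h7 : b / a = 1 := by
    have h8 := y.2.2
    simp only [h6] at h8
    rwa [← Finset.mul_sum, x.2.2, mul_one] at h8
  apply Subtype.ext
  funext i
  rw [h6 i, h7, one_mul]

theorem exists_simplexToSphere_eq {s : Sphere d} (hs : s ≠ Sphere.base d) :
    ∃ x, simplexToSphere d x = s := by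
  have hsum : s.1 0 ^ 2 + ∑ j : Fin d, s.1 j.succ ^ 2 = 1 := by
    have h := mem_sphere_zero_iff_norm.1 s.2
    rw [EuclideanSpace.norm_eq, Real.sqrt_eq_one] at h
    simp only [Real.norm_eq_abs, sq_abs] at h
    rwa [Fin.sum_univ_succ] at h
  have hnn : ∀ j : Fin d, j ∈ Finset.univ → 0 ≤ s.1 j.succ ^ 2 := fun _ _ => sq_nonneg _
  have hlt : s.1 0 < 1 := by
    by_contra hge
    have h1 : ∑ j : Fin d, s.1 j.succ ^ 2 = 0 := by
      have := Finset.sum_nonneg hnn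
      nlinarith
    have h0 : s.1 0 = 1 := by
      rw [h1] at hsum
      nlinarith
    rw [Finset.sum_eq_zero_iff_of_nonneg hnn] at h1
    refine hs (sphere_ext fun i => Fin.cases (by rw [h0, base_zero]) (fun j => ?_) i)
    rw [base_succ]
    exact pow_eq_zero_iff two_ne_zero |>.1 (h1 j (Finset.mem_univ _))
  have hpos : 0 < 1 - s.1 0 := by linarith
  -- Stereographic projection from the base point gives the required ratios of differences to
  -- minimum. Shifting `W` to have minimum `1` and dividing by the total `T` gives a point of the
  -- simplex with these ratios and minimum `T⁻¹`.
  let W : Fin (d + 1) → ℝ := Fin.cons 0 fun j => s.1 j.succ / (1 - s.1 0)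
  set T : ℝ := ∑ i, (W i + (1 - minCoord W)) with hT
  have hTi : ∀ i, 1 ≤ W i + (1 - minCoord W) := fun i => by linarith [minCoord_le W i]
  have hTpos : 0 < T := Finset.sum_pos (fun i _ => by linarith [hTi i]) Finset.univ_nonempty
  let x : Fin (d + 1) → ℝ := fun i => T⁻¹ * W i + T⁻¹ * (1 - minCoord W)
  have hx : x ∈ stdSimplex ℝ (Fin (d + 1)) := by
    constructor
    · intro i
      have := hTi i
      have : x i = T⁻¹ * (W i + (1 - minCoord W)) := by simp only [x]; ring
      rw [this]
      positivity
    · have : ∀ i, x i = T⁻¹ * (W i + (1 - minCoord W)) := fun i => by simp only [x]; ring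
      simp only [this]
      rw [← Finset.mul_sum, ← hT, inv_mul_cancel₀ hTpos.ne']
  have hm : minCoord x = T⁻¹ := by
    rw [minCoord_mul_add (inv_nonneg.2 hTpos.le)]
    ring
  have hz : ∀ j : Fin d, x j.succ - x 0 = T⁻¹ * (s.1 j.succ / (1 - s.1 0)) := fun j => by
    simp [x, W]
  have hN : diffSq x = T⁻¹ ^ 2 * ((1 + s.1 0) / (1 - s.1 0)) := by
    unfold diffSq
    simp only [hz, mul_pow, div_pow]
    rw [← Finset.mul_sum, ← Finset.sum_div]
    have : ∑ j : Fin d, s.1 j.succ ^ 2 = (1 + s.1 0) * (1 - s.1 0) := by linarith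
    rw [this]
    field_simp
  have hden : diffSq x + minCoord x ^ 2 = T⁻¹ ^ 2 * (2 / (1 - s.1 0)) := by
    rw [hN, hm]
    field_simp
    ring
  refine ⟨⟨x, hx⟩, sphere_ext fun i => ?_⟩
  rw [simplexToSphere_apply]
  refine Fin.cases ?_ (fun j => ?_) i
  · rw [sphereCoord_zero]
    simp only [hden]
    rw [hN, hm]
    field_simp
    ring
  · rw [sphereCoord_succ]
    simp only [hden]
    rw [hm, hz]
    field_simp

end SimplexToSphere

/-! ### Attaching simplices to a contractible complex -/

/-- The complex `K` arises from the subcomplex `A` by attaching simplices of dimension `d` along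
their whole boundaries; `e i` lists the vertices of the `i`-th of them. -/
structure AttachesSimplices {V : Type*} [DecidableEq V] (A K : PreAbstractSimplicialComplex V)
    {r d : ℕ} (e : Fin r → Fin (d + 1) → V) : Prop where
  le : A ≤ K
  injective : ∀ i, Function.Injective (e i)
  eq_of_subset : ∀ i j, Finset.univ.image (e i) ⊆ Finset.univ.image (e j) → i = j
  image_mem : ∀ i, Finset.univ.image (e i) ∈ K
  image_notMem : ∀ i, Finset.univ.image (e i) ∉ A
  exists_eq_image : ∀ s ∈ K, s ∉ A → ∃ i, s = Finset.univ.image (e i)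

/-! ### Barycentric coordinates on one attached simplex. -/

section CellMap

variable {V : Type*} [Fintype V] [DecidableEq V] {d : ℕ}

/-- The affine map which sends the vertices of the standard simplex to the basis vectors listed
by `f`. -/
def cellMap (f : Fin (d + 1) → V) (y : Fin (d + 1) → ℝ) : V → ℝ := fun v =>
  ∑ j, if f j = v then y j else 0

theorem continuous_cellMap {V : Type*} [DecidableEq V] (f : Fin (d + 1) → V) :
    Continuous (cellMap f) := by
  refine continuous_pi fun v => continuous_finsetSum _ fun j _ => ?_
  split_ifs
  · exact continuous_apply j
  · exact continuous_const

theorem cellMap_apply {V : Type*} [DecidableEq V] {f : Fin (d + 1) → V}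
    (hf : Function.Injective f) (y : Fin (d + 1) → ℝ) (j : Fin (d + 1)) :
    cellMap f y (f j) = y j := by
  simp [cellMap, hf.eq_iff]

theorem cellMap_eq_zero {V : Type*} [DecidableEq V] {f : Fin (d + 1) → V} {v : V}
    (hv : v ∉ Finset.univ.image f) (y : Fin (d + 1) → ℝ) : cellMap f y v = 0 := by
  simp only [Finset.mem_image, Finset.mem_univ, true_and, not_exists] at hv
  simp [cellMap, hv]

theorem cellMap_mem_stdSimplex (f : Fin (d + 1) → V) {y : Fin (d + 1) → ℝ}
    (hy : y ∈ stdSimplex ℝ (Fin (d + 1))) : cellMap f y ∈ stdSimplex ℝ V := by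
  constructor
  · intro v
    refine Finset.sum_nonneg fun j _ => ?_
    split_ifs
    · exact hy.1 j
    · exact le_rfl
  · unfold cellMap
    rw [Finset.sum_comm]
    simpa using hy.2

theorem comp_mem_stdSimplex {f : Fin (d + 1) → V} (hf : Function.Injective f) {x : V → ℝ}
    (hx : x ∈ stdSimplex ℝ V) (hc : carrier x ⊆ Finset.univ.image f) :
    x ∘ f ∈ stdSimplex ℝ (Fin (d + 1)) := by
  refine ⟨fun j => hx.1 _, ?_⟩
  rw [← hx.2, ← Finset.sum_subset (Finset.subset_univ (Finset.univ.image f))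
    fun v _ hv => carrier_subset.1 hc v hv, Finset.sum_image fun a _ b _ h => hf h]
  rfl

theorem cellMap_comp {f : Fin (d + 1) → V} (hf : Function.Injective f) {x : V → ℝ}
    (hc : carrier x ⊆ Finset.univ.image f) : cellMap f (x ∘ f) = x := by
  funext v
  by_cases hv : v ∈ Finset.univ.image f
  · obtain ⟨j, -, rfl⟩ := Finset.mem_image.1 hv
    rw [cellMap_apply hf]
    rfl
  · rw [cellMap_eq_zero hv, carrier_subset.1 hc v hv]

end CellMap

/-- The pinched simplex, together with a point over the base point, covers the sphere. -/
def sumSimplexToSphere (d : ℕ) : C(Unit ⊕ stdSimplex ℝ (Fin (d + 1)), Sphere d) :=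
  ⟨Sum.elim (fun _ => Sphere.base d) (simplexToSphere d),
    continuous_const.sumElim continuous_simplexToSphere⟩

/-- A continuous surjection from a compact to a Hausdorff space. The extra point matters for `d =
0`, where the simplex has no boundary and misses the base point. -/
theorem isQuotientMap_sumSimplexToSphere (d : ℕ) :
    Topology.IsQuotientMap (sumSimplexToSphere d) := by
  refine (sumSimplexToSphere d).continuous.isClosedMap.isQuotientMap
    (sumSimplexToSphere d).continuous fun s => ?_
  by_cases hs : s = Sphere.base d
  · exact ⟨Sum.inl (), hs.symm⟩
  · obtain ⟨x, hx⟩ := exists_simplexToSphere_eq hs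
    exact ⟨Sum.inr x, hx⟩

/-- The wedge point. -/
def Wedge.point {ι : Type*} {X : ι → Type*} (x₀ : ∀ i, X i) : Wedge x₀ := Quot.mk _ (Sum.inl ())

/-- The inclusion of a wedge summand. -/
def Wedge.incl {ι : Type*} {X : ι → Type*} (x₀ : ∀ i, X i) (i : ι) (x : X i) : Wedge x₀ :=
  Quot.mk _ (Sum.inr ⟨i, x⟩)

theorem Wedge.incl_base {ι : Type*} {X : ι → Type*} (x₀ : ∀ i, X i) (i : ι) :
    Wedge.incl x₀ i (x₀ i) = Wedge.point x₀ :=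
  (Quot.sound (WedgeRel.glue i)).symm

theorem Wedge.continuous_incl {ι : Type*} {X : ι → Type*} [∀ i, TopologicalSpace (X i)]
    (x₀ : ∀ i, X i) (i : ι) : Continuous (Wedge.incl x₀ i) :=
  continuous_quot_mk.comp (continuous_inr.comp continuous_sigmaMk)

/-- Pointed maps on the summands induce a map on the wedge. -/
def Wedge.desc {ι : Type*} {X : ι → Type*} [∀ i, TopologicalSpace (X i)] (x₀ : ∀ i, X i)
    {Z : Type*} [TopologicalSpace Z] (z : Z) (f : ∀ i, C(X i, Z)) (hf : ∀ i, f i (x₀ i) = z) :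
    C(Wedge x₀, Z) where
  toFun := Quot.lift (Sum.elim (fun _ => z) fun p => f p.1 p.2) (by
    rintro _ _ ⟨i⟩
    exact (hf i).symm)
  continuous_toFun := continuous_quot_lift _
    (continuous_const.sumElim (continuous_sigma fun i => (f i).continuous))

/-! ### Collapsing the subcomplex to a point. -/

namespace AttachesSimplices

variable {V : Type*} [Fintype V] [DecidableEq V] {A K : PreAbstractSimplicialComplex V}
  {r d : ℕ} {e : Fin r → Fin (d + 1) → V}

/-- A point of `K` lies in `A` or in the interior of exactly one attached simplex. -/
theorem mem_or_carrier_eq (h : AttachesSimplices A K e) {x : V → ℝ} (hx : x ∈ realization K) :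
    x ∈ realization A ∨ ∃ i, carrier x = Finset.univ.image (e i) := by
  rw [mem_realization_iff] at hx ⊢
  by_cases hA : carrier x ∈ A
  · exact Or.inl ⟨hx.1, hA⟩
  · exact Or.inr (h.exists_eq_image _ hx.2 hA)

theorem image_subset_carrier_iff {x : V → ℝ} (hx : x ∈ stdSimplex ℝ V) (i : Fin r) :
    Finset.univ.image (e i) ⊆ carrier x ↔ minCoord (x ∘ e i) ≠ 0 := by
  constructor
  · intro hs
    obtain ⟨j, hj⟩ := exists_eq_minCoord (x ∘ e i)
    rw [← hj]
    change x (e i j) ≠ 0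
    exact mem_carrier.1 (hs (Finset.mem_image_of_mem _ (Finset.mem_univ j)))
  · intro hm v hv
    obtain ⟨j, -, rfl⟩ := Finset.mem_image.1 hv
    rw [mem_carrier]
    have h1 := minCoord_le (x ∘ e i) j
    have h2 : 0 ≤ minCoord (x ∘ e i) := Finset.le_inf' _ _ fun j _ => hx.1 _
    have h3 := lt_of_le_of_ne h2 (Ne.symm hm)
    exact (h3.trans_le h1).ne'

theorem minCoord_eq_zero_of_mem (h : AttachesSimplices A K e) {x : V → ℝ}
    (hx : x ∈ realization A) (i : Fin r) : minCoord (x ∘ e i) = 0 := by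
  rw [mem_realization_iff] at hx
  by_contra hm
  refine h.image_notMem i (mem_of_subset hx.2 ((image_subset_carrier_iff hx.1 i).2 hm) ?_)
  exact nonempty_of_mem (h.image_mem i)

/-- A positive minimum on simplex `j` would place it inside simplex `i`. Thus at most one term of
the sums over all attached simplices is nonzero. -/
theorem minCoord_eq_zero_of_ne (h : AttachesSimplices A K e) {x : V → ℝ}
    (hx : x ∈ stdSimplex ℝ V) {i j : Fin r} (hi : carrier x ⊆ Finset.univ.image (e i))
    (hj : j ≠ i) : minCoord (x ∘ e j) = 0 := by
  by_contra hm
  exact hj (h.eq_of_subset _ _ (((image_subset_carrier_iff hx j).2 hm).trans hi))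

theorem mem_of_minCoord_eq_zero (h : AttachesSimplices A K e) {x : V → ℝ}
    (hx : x ∈ realization K) {i : Fin r} (hi : carrier x ⊆ Finset.univ.image (e i))
    (hm : minCoord (x ∘ e i) = 0) : x ∈ realization A := by
  refine (h.mem_or_carrier_eq hx).resolve_right ?_
  rintro ⟨j, hj⟩
  have hji := h.eq_of_subset j i (hj ▸ hi)
  subst hji
  exact (image_subset_carrier_iff hx.1 j).1 hj.symm.subset hm

/-- The characteristic map of an attached simplex. -/
def cell (h : AttachesSimplices A K e) (i : Fin r) :
    C(stdSimplex ℝ (Fin (d + 1)), realization K) :=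
  ⟨fun y => ⟨cellMap (e i) y, cellMap_mem_stdSimplex _ y.2, _, h.image_mem i,
      fun _ hv => cellMap_eq_zero hv _⟩,
    ((continuous_cellMap (e i)).comp continuous_subtype_val).subtype_mk _⟩

theorem cell_comp (h : AttachesSimplices A K e) (i : Fin r) (y : stdSimplex ℝ (Fin (d + 1))) :
    (h.cell i y : V → ℝ) ∘ e i = y.1 :=
  funext fun j => cellMap_apply (h.injective i) _ j

theorem carrier_cell (h : AttachesSimplices A K e) (i : Fin r)
    (y : stdSimplex ℝ (Fin (d + 1))) :
    carrier (h.cell i y : V → ℝ) ⊆ Finset.univ.image (e i) :=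
  carrier_subset.2 fun _ hv => cellMap_eq_zero hv _

theorem cell_mem_iff (h : AttachesSimplices A K e) (i : Fin r)
    (y : stdSimplex ℝ (Fin (d + 1))) :
    (h.cell i y : V → ℝ) ∈ realization A ↔ minCoord y.1 = 0 := by
  constructor
  · intro hA
    rw [← h.cell_comp i y]
    exact h.minCoord_eq_zero_of_mem hA i
  · intro hm
    exact h.mem_of_minCoord_eq_zero (h.cell i y).2 (h.carrier_cell i y) (by rwa [h.cell_comp])

/-- The subcomplex `A` and the attached simplices cover `K`. -/
def cover (h : AttachesSimplices A K e) :
    C(realization A ⊕ (Σ _ : Fin r, stdSimplex ℝ (Fin (d + 1))), realization K) :=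
  ⟨Sum.elim (Set.inclusion (realization_mono h.le)) fun p => h.cell p.1 p.2,
    (continuous_inclusion _).sumElim (continuous_sigma fun i => (h.cell i).continuous)⟩

theorem isQuotientMap_cover (h : AttachesSimplices A K e) : Topology.IsQuotientMap h.cover := by
  refine h.cover.continuous.isClosedMap.isQuotientMap h.cover.continuous fun x => ?_
  rcases h.mem_or_carrier_eq x.2 with hx | ⟨i, hi⟩
  · exact ⟨Sum.inl ⟨x, hx⟩, rfl⟩
  · refine ⟨Sum.inr ⟨i, ⟨x ∘ e i, comp_mem_stdSimplex (h.injective i) x.2.1 hi.subset⟩⟩, ?_⟩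
    exact Subtype.ext (cellMap_comp (h.injective i) hi.subset)

/-- The map to the wedge on the pieces of `h.cover`. -/
def coverToWedge (A : PreAbstractSimplicialComplex V) (r d : ℕ) :
    C(realization A ⊕ (Σ _ : Fin r, stdSimplex ℝ (Fin (d + 1))), WedgeOfSpheres r d) :=
  ⟨Sum.elim (fun _ => Wedge.point _) fun p => Wedge.incl _ p.1 (simplexToSphere d p.2),
    continuous_const.sumElim (continuous_sigma fun i =>
      (Wedge.continuous_incl _ i).comp continuous_simplexToSphere)⟩

/-- Pieces of the cover overlap only over `A`, where everything goes to the wedge point; elsewhere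
the simplex and the coordinates in it are determined. -/
theorem factorsThrough_cover (h : AttachesSimplices A K e) :
    Function.FactorsThrough (coverToWedge A r d) h.cover := by
  have key : ∀ (i : Fin r) (y : stdSimplex ℝ (Fin (d + 1))),
      (h.cell i y : V → ℝ) ∈ realization A →
      Wedge.incl (fun _ : Fin r => Sphere.base d) i (simplexToSphere d y) = Wedge.point _ := by
    intro i y hA
    rw [simplexToSphere_of_minCoord_eq_zero ((h.cell_mem_iff i y).1 hA)]
    exact Wedge.incl_base (fun _ : Fin r => Sphere.base d) i
  rintro (a | ⟨i, y⟩) (b | ⟨j, z⟩) hab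
  · rfl
  · refine (key j z ?_).symm
    have : (a : V → ℝ) = h.cell j z := congrArg Subtype.val hab
    exact this ▸ a.2
  · refine key i y ?_
    have : (h.cell i y : V → ℝ) = b := congrArg Subtype.val hab
    exact this ▸ b.2
  · have hab' : (h.cell i y : V → ℝ) = h.cell j z := congrArg Subtype.val hab
    by_cases hA : (h.cell i y : V → ℝ) ∈ realization A
    · exact (key i y hA).trans (key j z (hab' ▸ hA)).symm
    · have hij : i = j := by
        by_contra hne
        refine hA ((h.cell_mem_iff i y).2 ?_)
        rw [← h.cell_comp i y]
        exact h.minCoord_eq_zero_of_ne (h.cell i y).2.1 (hab' ▸ h.carrier_cell j z) hne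
      subst hij
      have hyz : y = z := by
        apply Subtype.ext
        rw [← h.cell_comp i y, ← h.cell_comp i z, hab']
      rw [hyz]

/-- The map which collapses `A` to a point. -/
def toWedge (h : AttachesSimplices A K e) : C(realization K, WedgeOfSpheres r d) :=
  h.isQuotientMap_cover.lift (coverToWedge A r d) h.factorsThrough_cover

theorem toWedge_cover (h : AttachesSimplices A K e)
    (a : realization A ⊕ (Σ _ : Fin r, stdSimplex ℝ (Fin (d + 1)))) :
    h.toWedge (h.cover a) = coverToWedge A r d a :=
  congrArg (fun f => f a)
    (h.isQuotientMap_cover.lift_comp (coverToWedge A r d) h.factorsThrough_cover)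

theorem toWedge_of_mem (h : AttachesSimplices A K e) {x : realization K}
    (hx : (x : V → ℝ) ∈ realization A) : h.toWedge x = Wedge.point _ :=
  h.toWedge_cover (Sum.inl ⟨x, hx⟩)

theorem toWedge_cell (h : AttachesSimplices A K e) (i : Fin r)
    (y : stdSimplex ℝ (Fin (d + 1))) :
    h.toWedge (h.cell i y) = Wedge.incl _ i (simplexToSphere d y) :=
  h.toWedge_cover (Sum.inr ⟨i, y⟩)

theorem surjective_toWedge (h : AttachesSimplices A K e) (hne : (realization A).Nonempty) :
    Function.Surjective h.toWedge := by
  obtain ⟨a, ha⟩ := hne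
  have hpt : h.toWedge ⟨a, realization_mono h.le ha⟩ = Wedge.point _ := h.toWedge_of_mem ha
  rintro ⟨⟨⟩ | ⟨i, s⟩⟩
  · exact ⟨_, hpt⟩
  · by_cases hs : s = Sphere.base d
    · subst hs
      exact ⟨_, hpt.trans (Wedge.incl_base (fun _ : Fin r => Sphere.base d) i).symm⟩
    · obtain ⟨y, rfl⟩ := exists_simplexToSphere_eq hs
      exact ⟨_, h.toWedge_cell i y⟩

section Desc

variable {Z : Type*} [TopologicalSpace Z] (f : C(realization K, Z)) (z : Z)

/-- The map to `Z` on the pieces covering a sphere. -/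
def sumDesc (h : AttachesSimplices A K e) (i : Fin r) : C(Unit ⊕ stdSimplex ℝ (Fin (d + 1)), Z) :=
  ⟨Sum.elim (fun _ => z) fun y => f (h.cell i y),
    continuous_const.sumElim (f.comp (h.cell i)).continuous⟩

theorem factorsThrough_sumSimplexToSphere (h : AttachesSimplices A K e)
    (hf : ∀ x : realization K, (x : V → ℝ) ∈ realization A → f x = z) (i : Fin r) :
    Function.FactorsThrough (h.sumDesc f z i) (sumSimplexToSphere d) := by
  have key : ∀ y : stdSimplex ℝ (Fin (d + 1)), minCoord y.1 = 0 → f (h.cell i y) = z :=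
    fun y hy => hf _ ((h.cell_mem_iff i y).2 hy)
  have key' : ∀ y : stdSimplex ℝ (Fin (d + 1)), simplexToSphere d y = Sphere.base d →
      f (h.cell i y) = z := by
    intro y hy
    refine key y ?_
    by_contra hm
    exact simplexToSphere_ne_base hm hy
  rintro (a | y) (b | y') hab
  · rfl
  · exact (key' y' hab.symm).symm
  · exact key' y hab
  · rcases simplexToSphere_inj hab with hyy | ⟨h1, h2⟩
    · rw [hyy]
    · exact (key y h1).trans (key y' h2).symm

/-- A map on `K` which is constant on `A` descends to the wedge. -/
def desc (h : AttachesSimplices A K e)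
    (hf : ∀ x : realization K, (x : V → ℝ) ∈ realization A → f x = z) :
    C(WedgeOfSpheres r d, Z) :=
  Wedge.desc _ z (fun i => (isQuotientMap_sumSimplexToSphere d).lift (h.sumDesc f z i)
    (h.factorsThrough_sumSimplexToSphere f z hf i)) fun i =>
      congrArg (fun g => g (Sum.inl ())) ((isQuotientMap_sumSimplexToSphere d).lift_comp
        (h.sumDesc f z i) (h.factorsThrough_sumSimplexToSphere f z hf i))

theorem desc_toWedge (h : AttachesSimplices A K e)
    (hf : ∀ x : realization K, (x : V → ℝ) ∈ realization A → f x = z) (x : realization K) :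
    h.desc f z hf (h.toWedge x) = f x := by
  obtain ⟨a | ⟨i, y⟩, rfl⟩ := h.isQuotientMap_cover.surjective x
  · rw [toWedge_cover]
    exact (hf _ a.2).symm
  · rw [toWedge_cover]
    exact congrArg (fun g => g (Sum.inr y)) ((isQuotientMap_sumSimplexToSphere d).lift_comp
        (h.sumDesc f z i) (h.factorsThrough_sumSimplexToSphere f z hf i))

end Desc

/-- If the inclusion of `A` can be contracted inside `A` by a homotopy of `K`, then collapsing `A`
to a point is a homotopy equivalence. -/
theorem nonempty_homotopyEquiv_of_homotopy (h : AttachesSimplices A K e)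
    (F : C(unitInterval × realization K, realization K)) (a : realization A)
    (hF0 : ∀ x, F (0, x) = x)
    (hFA : ∀ τ, ∀ x : realization K, (x : V → ℝ) ∈ realization A →
      (F (τ, x) : V → ℝ) ∈ realization A)
    (hF1 : ∀ x : realization K, (x : V → ℝ) ∈ realization A → (F (1, x) : V → ℝ) = a) :
    Nonempty (realization K ≃ₕ WedgeOfSpheres r d) := by
  -- The end of the homotopy is constant on `A`, so it descends to the homotopy inverse `g` of
  -- `toWedge`.
  let f : C(realization K, realization K) := ⟨fun x => F (1, x), by fun_prop⟩
  let a' : realization K := ⟨a, realization_mono h.le a.2⟩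
  have hf : ∀ x : realization K, (x : V → ℝ) ∈ realization A → f x = a' :=
    fun x hx => Subtype.ext (hF1 x hx)
  let g := h.desc f a' hf
  have hg : ∀ x, g (h.toWedge x) = F (1, x) := h.desc_toWedge f a' hf
  -- Descending a map into the path space avoids asking whether a quotient map times the interval is
  -- again a quotient map.
  let F' : C(realization K, C(unitInterval, WedgeOfSpheres r d)) :=
    ContinuousMap.curry ⟨fun p : realization K × unitInterval => h.toWedge (F (p.2, p.1)),
      by fun_prop⟩
  have hF' : ∀ x : realization K, (x : V → ℝ) ∈ realization A →
      F' x = ContinuousMap.const _ (Wedge.point _) := by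
    intro x hx
    ext1 τ
    exact h.toWedge_of_mem (hFA τ x hx)
  let G := h.desc F' _ hF'
  have hG : ∀ x τ, G (h.toWedge x) τ = h.toWedge (F (τ, x)) := fun x τ => by
    rw [show G (h.toWedge x) = F' x from h.desc_toWedge F' _ hF' x]
    rfl
  have hsurj := h.surjective_toWedge ⟨a, a.2⟩
  let H1 : (ContinuousMap.id (realization K)).Homotopy (g.comp h.toWedge) :=
    { toFun := F
      continuous_toFun := F.continuous
      map_zero_left := hF0
      map_one_left := fun x => (hg x).symm }
  let H2 : (ContinuousMap.id (WedgeOfSpheres r d)).Homotopy (h.toWedge.comp g) :=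
    { toFun := fun p => G p.2 p.1
      continuous_toFun := by fun_prop
      map_zero_left := fun w => by
        obtain ⟨x, rfl⟩ := hsurj w
        rw [hG, hF0]
        rfl
      map_one_left := fun w => by
        obtain ⟨x, rfl⟩ := hsurj w
        rw [hG]
        exact congrArg h.toWedge (hg x).symm }
  exact ⟨⟨h.toWedge, g, ⟨H1.symm⟩, ⟨H2.symm⟩⟩⟩

end AttachesSimplices

/-! ### Extending a contraction of the subcomplex -/

namespace AttachesSimplices

variable {V : Type*} [Fintype V] [DecidableEq V] {A K : PreAbstractSimplicialComplex V}
  {r d : ℕ} {e : Fin r → Fin (d + 1) → V}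

/-- The sum of the least coordinates in the attached simplices; it vanishes exactly on `A`. -/
def depth (e : Fin r → Fin (d + 1) → V) (x : V → ℝ) : ℝ := ∑ i, minCoord (x ∘ e i)

/-- Radial expansion of the attached simplices; it pushes the points of depth at most `c`
into `A`. -/
def expand (e : Fin r → Fin (d + 1) → V) (c : ℝ) (x : V → ℝ) : V → ℝ := fun v =>
  (x v - ∑ i, if v ∈ Finset.univ.image (e i) then min (minCoord (x ∘ e i)) c else 0) /
    (1 - ((d : ℝ) + 1) * ∑ i, min (minCoord (x ∘ e i)) c)

theorem depth_of_mem (h : AttachesSimplices A K e) {x : V → ℝ} (hx : x ∈ realization A) :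
    depth e x = 0 :=
  Finset.sum_eq_zero fun i _ => h.minCoord_eq_zero_of_mem hx i

theorem expand_of_mem (h : AttachesSimplices A K e) {c : ℝ} (hc : 0 ≤ c) {x : V → ℝ}
    (hx : x ∈ realization A) : expand e c x = x := by
  funext v
  simp [expand, h.minCoord_eq_zero_of_mem hx, hc]

theorem depth_of_carrier (h : AttachesSimplices A K e) {x : V → ℝ} (hx : x ∈ stdSimplex ℝ V)
    {i : Fin r} (hi : carrier x ⊆ Finset.univ.image (e i)) : depth e x = minCoord (x ∘ e i) :=
  Finset.sum_eq_single i (fun _ _ hj => h.minCoord_eq_zero_of_ne hx hi hj) (by simp)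

theorem sum_min_of_carrier (h : AttachesSimplices A K e) {c : ℝ} (hc : 0 ≤ c) {x : V → ℝ}
    (hx : x ∈ stdSimplex ℝ V) {i : Fin r} (hi : carrier x ⊆ Finset.univ.image (e i)) :
    ∑ j, min (minCoord (x ∘ e j)) c = min (minCoord (x ∘ e i)) c :=
  Finset.sum_eq_single i
    (fun j _ hj => by rw [h.minCoord_eq_zero_of_ne hx hi hj, min_eq_left hc]) (by simp)

theorem expand_of_carrier (h : AttachesSimplices A K e) {c : ℝ} (hc : 0 ≤ c) {x : V → ℝ}
    (hx : x ∈ stdSimplex ℝ V) {i : Fin r} (hi : carrier x ⊆ Finset.univ.image (e i)) (v : V) :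
    expand e c x v =
      (x v - if v ∈ Finset.univ.image (e i) then min (minCoord (x ∘ e i)) c else 0) /
        (1 - ((d : ℝ) + 1) * min (minCoord (x ∘ e i)) c) := by
  unfold expand
  rw [h.sum_min_of_carrier hc hx hi, Finset.sum_eq_single i _ (by simp)]
  intro j _ hj
  rw [h.minCoord_eq_zero_of_ne hx hi hj, min_eq_left hc, ite_self]

/-- The barycentre of an attached simplex has least coordinate `1 / (d + 1)`; bounding `c` by half
of this keeps the expansion from dividing by zero. -/
theorem denom_pos (h : AttachesSimplices A K e) {c : ℝ} (hc : 0 ≤ c)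
    (hc' : ((d : ℝ) + 1) * c ≤ 1 / 2) {x : V → ℝ} (hx : x ∈ realization K) :
    0 < 1 - ((d : ℝ) + 1) * ∑ i, min (minCoord (x ∘ e i)) c := by
  rcases h.mem_or_carrier_eq hx with hA | ⟨i, hi⟩
  · simp [h.minCoord_eq_zero_of_mem hA, hc]
  · rw [h.sum_min_of_carrier hc hx.1 hi.subset]
    have : ((d : ℝ) + 1) * min (minCoord (x ∘ e i)) c ≤ ((d : ℝ) + 1) * c :=
      mul_le_mul_of_nonneg_left (min_le_right _ _) (by positivity)
    linarith

theorem carrier_expand (h : AttachesSimplices A K e) {c : ℝ} (hc : 0 ≤ c) {x : V → ℝ}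
    (hx : x ∈ stdSimplex ℝ V) {i : Fin r} (hi : carrier x ⊆ Finset.univ.image (e i)) :
    carrier (expand e c x) ⊆ Finset.univ.image (e i) := by
  rw [carrier_subset]
  intro v hv
  rw [h.expand_of_carrier hc hx hi, if_neg hv, carrier_subset.1 hi v hv]
  simp

theorem expand_mem (h : AttachesSimplices A K e) {c : ℝ} (hc : 0 ≤ c)
    (hc' : ((d : ℝ) + 1) * c ≤ 1 / 2) {x : V → ℝ} (hx : x ∈ realization K) :
    expand e c x ∈ realization K := by
  rcases h.mem_or_carrier_eq hx with hA | ⟨i, hi⟩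
  · rwa [h.expand_of_mem hc hA]
  · have hpos := h.denom_pos hc hc' hx
    rw [h.sum_min_of_carrier hc hx.1 hi.subset] at hpos
    refine ⟨⟨fun v => ?_, ?_⟩, _, h.image_mem i,
      carrier_subset.1 (h.carrier_expand hc hx.1 hi.subset)⟩
    · rw [h.expand_of_carrier hc hx.1 hi.subset]
      refine div_nonneg ?_ hpos.le
      split_ifs with hv
      · obtain ⟨j, -, rfl⟩ := Finset.mem_image.1 hv
        have h1 := minCoord_le (x ∘ e i) j
        have h2 := min_le_left (minCoord (x ∘ e i)) c
        simp only [Function.comp_apply] at h1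
        linarith
      · rw [sub_zero]
        exact hx.1.1 v
    · simp only [h.expand_of_carrier hc hx.1 hi.subset]
      rw [← Finset.sum_div, Finset.sum_sub_distrib, hx.1.2, Finset.sum_ite_mem,
        Finset.univ_inter, Finset.sum_const, Finset.card_image_of_injective _ (h.injective i)]
      simp only [Finset.card_univ, Fintype.card_fin, nsmul_eq_mul, Nat.cast_add, Nat.cast_one]
      exact div_self hpos.ne'

/-- When the minimum is at most `c` it is subtracted in full, so some coordinate becomes `0` and the
point reaches the boundary. -/
theorem expand_mem_of_depth_le (h : AttachesSimplices A K e) {c : ℝ} (hc : 0 ≤ c)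
    (hc' : ((d : ℝ) + 1) * c ≤ 1 / 2) {x : V → ℝ} (hx : x ∈ realization K)
    (hd : depth e x ≤ c) : expand e c x ∈ realization A := by
  rcases h.mem_or_carrier_eq hx with hA | ⟨i, hi⟩
  · rwa [h.expand_of_mem hc hA]
  · rw [h.depth_of_carrier hx.1 hi.subset] at hd
    have hE := h.expand_mem hc hc' hx
    refine h.mem_of_minCoord_eq_zero hE (h.carrier_expand hc hx.1 hi.subset) ?_
    obtain ⟨j, hj⟩ := exists_eq_minCoord (x ∘ e i)
    refine le_antisymm ?_ (Finset.le_inf' _ _ fun j _ => hE.1.1 _)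
    refine (minCoord_le _ j).trans_eq ?_
    rw [Function.comp_apply, h.expand_of_carrier hc hx.1 hi.subset,
      if_pos (Finset.mem_image_of_mem _ (Finset.mem_univ j)), min_eq_left hd, ← hj]
    simp

theorem continuous_minCoord_comp {V : Type*} (f : Fin (d + 1) → V) :
    Continuous fun x : V → ℝ => minCoord (x ∘ f) :=
  continuous_minCoord.comp (continuous_pi fun j => continuous_apply (f j))

theorem continuous_depth {V : Type*} (e : Fin r → Fin (d + 1) → V) : Continuous (depth e) :=
  continuous_finsetSum _ fun i _ => continuous_minCoord_comp (e i)

/-- The radius of expansion at time `τ`. -/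
def radius (d : ℕ) (τ : unitInterval) : ℝ := τ / (2 * ((d : ℝ) + 1))

theorem radius_nonneg (τ : unitInterval) : 0 ≤ radius d τ :=
  div_nonneg τ.2.1 (by positivity)

theorem mul_radius (τ : unitInterval) : ((d : ℝ) + 1) * radius d τ = τ / 2 := by
  unfold radius
  field_simp

theorem mul_radius_le (τ : unitInterval) : ((d : ℝ) + 1) * radius d τ ≤ 1 / 2 := by
  rw [mul_radius]
  linarith [τ.2.2]

theorem continuous_radius : Continuous (radius d) := by
  unfold radius
  fun_prop

theorem continuous_expand (h : AttachesSimplices A K e) :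
    Continuous fun p : unitInterval × realization K => expand e (radius d p.1) p.2 := by
  have hm : ∀ i, Continuous fun p : unitInterval × realization K =>
      min (minCoord ((p.2 : V → ℝ) ∘ e i)) (radius d p.1) := fun i =>
    ((continuous_minCoord_comp (e i)).comp (continuous_subtype_val.comp continuous_snd)).min
      (continuous_radius.comp continuous_fst)
  refine continuous_pi fun v => Continuous.div ?_ ?_ fun p =>
    (h.denom_pos (radius_nonneg p.1) (mul_radius_le p.1) p.2.2).ne'
  · refine Continuous.sub ?_ (continuous_finsetSum _ fun i _ => ?_)
    · exact (continuous_apply v).comp (continuous_subtype_val.comp continuous_snd)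
    · split_ifs
      · exact hm i
      · exact continuous_const
  · exact continuous_const.sub (continuous_const.mul (continuous_finsetSum _ fun i _ => hm i))

open Classical in
/-- A contraction of `A`, extended to `K`. -/
def extendHomotopy (h : AttachesSimplices A K e) {a : realization A}
    (H : (ContinuousMap.id (realization A)).Homotopy (ContinuousMap.const _ a))
    (p : unitInterval × realization K) : realization K :=
  -- Points expanded into `A` are then moved by `H` for the time `τ - 2 (d + 1) depth`. This is `τ`
  -- on `A` and falls to `0` where the depth equals the radius, so the two branches agree there.
  if hd : depth e p.2 ≤ radius d p.1 then
    Set.inclusion (realization_mono h.le)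
      (H (Set.projIcc 0 1 zero_le_one ((p.1 : ℝ) - 2 * (((d : ℝ) + 1) * depth e p.2)),
        ⟨expand e (radius d p.1) p.2,
          h.expand_mem_of_depth_le (radius_nonneg _) (mul_radius_le _) p.2.2 hd⟩))
  else ⟨expand e (radius d p.1) p.2, h.expand_mem (radius_nonneg _) (mul_radius_le _) p.2.2⟩

theorem extendHomotopy_of_le (h : AttachesSimplices A K e) {a : realization A}
    (H : (ContinuousMap.id (realization A)).Homotopy (ContinuousMap.const _ a))
    {p : unitInterval × realization K} (hd : radius d p.1 ≤ depth e p.2) :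
    h.extendHomotopy H p =
      ⟨expand e (radius d p.1) p.2, h.expand_mem (radius_nonneg _) (mul_radius_le _) p.2.2⟩ := by
  unfold extendHomotopy
  split_ifs with hd'
  · have heq : depth e p.2 = radius d p.1 := le_antisymm hd' hd
    have h0 : (p.1 : ℝ) - 2 * (((d : ℝ) + 1) * depth e p.2) = 0 := by
      rw [heq, mul_radius]
      ring
    rw [h0, Set.projIcc_left]
    exact congrArg (Set.inclusion (realization_mono h.le)) (H.apply_zero _)
  · rfl

theorem continuous_extendHomotopy (h : AttachesSimplices A K e) {a : realization A}
    (H : (ContinuousMap.id (realization A)).Homotopy (ContinuousMap.const _ a)) :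
    Continuous (h.extendHomotopy H) := by
  have hdep : Continuous fun p : unitInterval × realization K => depth e p.2 :=
    (continuous_depth e).comp (continuous_subtype_val.comp continuous_snd)
  have hrad : Continuous fun p : unitInterval × realization K => radius d p.1 :=
    continuous_radius.comp continuous_fst
  have hE := h.continuous_expand
  rw [← continuousOn_univ]
  have hU : (Set.univ : Set (unitInterval × realization K)) =
      {p | depth e p.2 ≤ radius d p.1} ∪ {p | radius d p.1 ≤ depth e p.2} := by
    ext p
    simpa using le_total _ _
  rw [hU]
  refine ContinuousOn.union_of_isClosed ?_ ?_ (isClosed_le hdep hrad) (isClosed_le hrad hdep)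
  · rw [continuousOn_iff_continuous_domRestrict]
    have : Set.domRestrict {p : unitInterval × realization K | depth e p.2 ≤ radius d p.1}
        (h.extendHomotopy H) = fun p => Set.inclusion (realization_mono h.le)
      (H (Set.projIcc 0 1 zero_le_one ((p.1.1 : ℝ) - 2 * (((d : ℝ) + 1) * depth e p.1.2)),
        ⟨expand e (radius d p.1.1) p.1.2,
          h.expand_mem_of_depth_le (radius_nonneg _) (mul_radius_le _) p.1.2.2 p.2⟩)) := by
      funext p
      exact dif_pos p.2
    rw [this]
    refine (continuous_inclusion (realization_mono h.le)).comp (H.continuous.comp (Continuous.prodMk ?_ ?_))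
    · have := hdep.comp (continuous_subtype_val
        (p := fun p : unitInterval × realization K => depth e p.2 ≤ radius d p.1))
      refine continuous_projIcc.comp (Continuous.sub (by fun_prop) ?_)
      exact continuous_const.mul (continuous_const.mul this)
    · exact (hE.comp continuous_subtype_val).subtype_mk _
  · exact (hE.subtype_mk fun p => h.expand_mem (radius_nonneg _) (mul_radius_le _) p.2.2).continuousOn.congr
      fun p hp => h.extendHomotopy_of_le H hp

theorem extendHomotopy_of_mem (h : AttachesSimplices A K e) {a : realization A}
    (H : (ContinuousMap.id (realization A)).Homotopy (ContinuousMap.const _ a)) (τ : unitInterval)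
    {x : realization K} (hx : (x : V → ℝ) ∈ realization A) :
    h.extendHomotopy H (τ, x) = Set.inclusion (realization_mono h.le) (H (τ, ⟨x, hx⟩)) := by
  have hd := h.depth_of_mem hx
  unfold extendHomotopy
  rw [dif_pos (by rw [hd]; exact radius_nonneg _)]
  congr 3
  · simp [hd]
  · exact Subtype.ext (h.expand_of_mem (radius_nonneg _) hx)

/-- Attaching `r` simplices of dimension `d` to a contractible complex gives a wedge of `r`
spheres of dimension `d`. -/
theorem nonempty_homotopyEquiv (h : AttachesSimplices A K e) [ContractibleSpace (realization A)] :
    Nonempty (realization K ≃ₕ WedgeOfSpheres r d) := by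
  obtain ⟨a, ⟨H⟩⟩ := id_nullhomotopic (realization A)
  refine h.nonempty_homotopyEquiv_of_homotopy
    ⟨h.extendHomotopy H, h.continuous_extendHomotopy H⟩ a ?_ ?_ ?_
  · intro x
    have h0 : radius d 0 = 0 := by simp [radius]
    have hd : 0 ≤ depth e x := Finset.sum_nonneg fun i _ => Finset.le_inf' _ _ fun j _ => x.2.1.1 _
    refine (h.extendHomotopy_of_le H (p := (0, x)) (by simpa [h0] using hd)).trans ?_
    apply Subtype.ext
    funext v
    have hm : ∀ i, min (minCoord ((x : V → ℝ) ∘ e i)) 0 = 0 := fun i =>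
      min_eq_right (Finset.le_inf' _ _ fun j _ => x.2.1.1 _)
    simp [expand, h0, hm]
  · intro τ x hx
    change (h.extendHomotopy H (τ, x) : V → ℝ) ∈ _
    rw [h.extendHomotopy_of_mem H τ hx]
    exact (H (τ, ⟨x, hx⟩)).2
  · intro x hx
    change (h.extendHomotopy H (1, x) : V → ℝ) = _
    rw [h.extendHomotopy_of_mem H 1 hx, H.apply_one]
    rfl

end AttachesSimplices

/-- If all simplices of `K` outside a contractible subcomplex have dimension `d`, then `K` is
homotopy equivalent to a wedge of `d`-spheres, one for each of these simplices. -/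
theorem nonempty_homotopyEquiv_wedgeOfSpheres {V : Type*} [Fintype V] [DecidableEq V]
    {A K : PreAbstractSimplicialComplex V} (hAK : A ≤ K) {r d : ℕ} (S : Finset (Finset V))
    (hS : ∀ s, s ∈ S ↔ s ∈ K ∧ s ∉ A) (hcard : ∀ s ∈ S, s.card = d + 1) (hr : S.card = r)
    [ContractibleSpace (realization A)] :
    Nonempty (realization K ≃ₕ WedgeOfSpheres r d) := by
  let c : Fin r ≃ S := (S.equivFinOfCardEq hr).symm
  let e : Fin r → Fin (d + 1) → V := fun i j =>
    ((c i).1.equivFinOfCardEq (hcard _ (c i).2)).symm j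
  have himg : ∀ i, Finset.univ.image (e i) = (c i).1 := by
    intro i
    ext v
    simp only [Finset.mem_image, Finset.mem_univ, true_and, e]
    constructor
    · rintro ⟨j, rfl⟩
      exact Subtype.prop _
    · intro hv
      exact ⟨(c i).1.equivFinOfCardEq (hcard _ (c i).2) ⟨v, hv⟩, by simp⟩
  have h : AttachesSimplices A K e :=
    { le := hAK
      injective := fun i => Subtype.val_injective.comp (Equiv.injective _)
      eq_of_subset := fun i j hij => by
        rw [himg, himg] at hij
        refine c.injective (Subtype.ext (Finset.eq_of_subset_of_card_le hij ?_))
        rw [hcard _ (c i).2, hcard _ (c j).2]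
      image_mem := fun i => by
        rw [himg]
        exact ((hS _).1 (c i).2).1
      image_notMem := fun i => by
        rw [himg]
        exact ((hS _).1 (c i).2).2
      exists_eq_image := fun s hs hsA => by
        refine ⟨c.symm ⟨s, (hS s).2 ⟨hs, hsA⟩⟩, ?_⟩
        rw [himg, Equiv.apply_symm_apply] }
  exact h.nonempty_homotopyEquiv

/-! ### Skeleta of the simplex -/

/-- A disjoint `k`-face exists iff the complement has at least `k + 1` vertices. -/
theorem mem_theta_Simp {n k : ℕ} {s : Finset (Fin (n + 1))} :
    s ∈ theta (Simp n k) ↔ s.Nonempty ∧ s.card + k ≤ n := by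
  change (s.Nonempty ∧ ∃ h : Set (Fin (n + 1)), (∃ u : Finset (Fin (n + 1)), u.Nonempty ∧
    u.card = k + 1 ∧ (u : Set (Fin (n + 1))) = h) ∧
      (s : Set (Fin (n + 1))) ⊆ {v | ({v} : Finset (Fin (n + 1))).Nonempty} \ h) ↔ _
  refine and_congr_right fun _ => ⟨?_, fun h => ?_⟩
  · rintro ⟨_, ⟨u, -, hu, rfl⟩, hsu⟩
    have hd : Disjoint s u := Finset.disjoint_left.2 fun v hv hv' => (hsu hv).2 hv'
    have h1 := Finset.card_le_univ (s ∪ u)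
    rw [Finset.card_union_of_disjoint hd, hu, Fintype.card_fin] at h1
    omega
  · have h1 : k + 1 ≤ sᶜ.card := by
      rw [Finset.card_compl, Fintype.card_fin]
      omega
    obtain ⟨u, hu, hu'⟩ := Finset.exists_subset_card_eq h1
    refine ⟨u, ⟨u, Finset.card_pos.1 (by omega), hu', rfl⟩, fun v hv => ⟨by simp, fun hv' => ?_⟩⟩
    exact Finset.mem_compl.1 (hu hv') hv

/-- The star of the vertex `0` in the theta complex of `Simp n k`. -/
def simpStar (n k : ℕ) : PreAbstractSimplicialComplex (Fin (n + 1)) where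
  faces := {s | s.Nonempty ∧ (insert 0 s).card + k ≤ n}
  isRelLowerSet_faces := by
    rintro s ⟨hs, h⟩
    refine ⟨hs, fun t hts ht => ⟨ht, ?_⟩⟩
    have := Finset.card_le_card (Finset.insert_subset_insert 0 hts)
    omega

theorem mem_simpStar {n k : ℕ} {s : Finset (Fin (n + 1))} :
    s ∈ simpStar n k ↔ s.Nonempty ∧ (insert 0 s).card + k ≤ n := Iff.rfl

/-- The complex consisting of one vertex. -/
def pointComplex {V : Type*} (v : V) : PreAbstractSimplicialComplex V where
  faces := {s | s = {v}}
  isRelLowerSet_faces := by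
    rintro s rfl
    exact ⟨Finset.singleton_nonempty v, fun t hts ht =>
      (Finset.subset_singleton_iff.1 hts).resolve_left ht.ne_empty⟩

theorem mem_pointComplex {V : Type*} {v : V} {s : Finset V} : s ∈ pointComplex v ↔ s = {v} :=
  Iff.rfl

theorem contractibleSpace_pointComplex {V : Type*} [Fintype V] (v : V) :
    ContractibleSpace (realization (pointComplex v)) :=
  contractibleSpace_realization_of_singleton v fun _ => mem_pointComplex

/-- A complex which is closed under adding the vertex `v` has contractible realization. -/
theorem contractibleSpace_of_cone {V : Type*} [Fintype V] [DecidableEq V]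
    {K : PreAbstractSimplicialComplex V} (v : V) (hv : {v} ∈ K) (h : ∀ s ∈ K, insert v s ∈ K) :
    ContractibleSpace (realization K) := by
  have := contractibleSpace_pointComplex v
  refine contractibleSpace_of_toggle (L := pointComplex v) ?_ v (fun s hs _ => h s hs) ?_
  · rintro _ rfl
    exact hv
  · intro s hs hsv
    rw [mem_pointComplex] at hsv ⊢
    refine ⟨?_, fun h1 => ?_⟩
    · rw [Finset.nonempty_iff_ne_empty, Ne, Finset.erase_eq_empty_iff]
      rintro (h1 | h1)
      · exact (nonempty_of_mem hs).ne_empty h1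
      · exact hsv h1
    · exact Finset.notMem_erase v s (h1 ▸ Finset.mem_singleton_self v)

theorem contractibleSpace_simpStar {n k : ℕ} (hk : k < n) :
    ContractibleSpace (realization (simpStar n k)) := by
  refine contractibleSpace_of_cone 0 (mem_simpStar.2 ⟨Finset.singleton_nonempty _, ?_⟩) ?_
  · simp
    omega
  · intro s hs
    rw [mem_simpStar] at hs ⊢
    refine ⟨Finset.insert_nonempty _ _, ?_⟩
    rw [Finset.insert_idem]
    exact hs.2

/-- A simplex lies outside the star iff adding `0` makes it too large: it avoids `0` and already has
`n - k` vertices. -/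
theorem nonempty_homotopyEquiv_theta_Simp {n k : ℕ} (hk : k < n) :
    Nonempty (realization (theta (Simp n k)) ≃ₕ
      WedgeOfSpheres (n.choose (n - k)) (n - k - 1)) := by
  have := contractibleSpace_simpStar hk
  have hS : ∀ s, s ∈ (Finset.univ.erase (0 : Fin (n + 1))).powersetCard (n - k) ↔
      s ∈ theta (Simp n k) ∧ s ∉ simpStar n k := by
    intro s
    rw [Finset.mem_powersetCard, Finset.subset_erase, mem_theta_Simp, mem_simpStar]
    by_cases h0 : (0 : Fin (n + 1)) ∈ s
    · rw [Finset.insert_eq_of_mem h0]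
      tauto
    · rw [Finset.card_insert_of_notMem h0, ← Finset.card_pos]
      simp only [Finset.subset_univ, h0, not_false_eq_true, true_and]
      omega
  refine nonempty_homotopyEquiv_wedgeOfSpheres (A := simpStar n k) ?_ _ hS ?_ ?_
  · intro s hs
    have hs := mem_simpStar.1 hs
    refine mem_theta_Simp.2 ⟨hs.1, ?_⟩
    have := Finset.card_le_card (Finset.subset_insert 0 s)
    omega
  · intro s hs
    rw [(Finset.mem_powersetCard.1 hs).2]
    omega
  · rw [Finset.card_powersetCard, Finset.card_erase_of_mem (Finset.mem_univ _)]
    simp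

theorem isEmpty_theta_Simp (n : ℕ) : IsEmpty (realization (theta (Simp n n))) := by
  refine ⟨fun x => ?_⟩
  obtain ⟨s, hs, -⟩ := x.2.2
  rw [mem_theta_Simp, ← Finset.card_pos] at hs
  omega

/-! ### The theta complex of the cross-polytope -/

/-- The indices of the antipodal pairs contained in a set of vertices of the cross-polytope. -/
def fullPairs {n : ℕ} (s : Finset (Fin n × Bool)) : Finset (Fin n) :=
  Finset.univ.filter fun i => (i, true) ∈ s ∧ (i, false) ∈ s

theorem mem_fullPairs {n : ℕ} {s : Finset (Fin n × Bool)} {i : Fin n} :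
    i ∈ fullPairs s ↔ (i, true) ∈ s ∧ (i, false) ∈ s := by
  simp [fullPairs]

theorem fullPairs_mono {n : ℕ} {s t : Finset (Fin n × Bool)} (h : s ⊆ t) :
    fullPairs s ⊆ fullPairs t := fun i hi => by
  rw [mem_fullPairs] at hi ⊢
  exact ⟨h hi.1, h hi.2⟩

/-- A `k`-face uses `k + 1` distinct indices, one sign each. If it is disjoint from `s`, none of
them is a full pair of `s`; conversely, any `k + 1` indices outside `fullPairs s` give such a face
by taking at each a sign absent from `s`. -/
theorem mem_theta_CrossPoly {n k : ℕ} {s : Finset (Fin n × Bool)} :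
    s ∈ theta (CrossPoly n k) ↔ s.Nonempty ∧ (fullPairs s).card + k + 1 ≤ n := by
  change (s.Nonempty ∧ ∃ h : Set (Fin n × Bool), (∃ u ∈ crossPolytope n,
    u.card = k + 1 ∧ (u : Set (Fin n × Bool)) = h) ∧
      (s : Set (Fin n × Bool)) ⊆ {v | {v} ∈ crossPolytope n} \ h) ↔ _
  refine and_congr_right fun _ => ⟨?_, fun h => ?_⟩
  · rintro ⟨_, ⟨u, hu, huk, rfl⟩, hsu⟩
    have hu2 : ∀ i, ¬ ((i, true) ∈ u ∧ (i, false) ∈ u) := hu.2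
    have hinj : Set.InjOn Prod.fst (u : Set (Fin n × Bool)) := by
      rintro ⟨i, b⟩ hi ⟨j, c⟩ hj hij
      have hij : i = j := hij
      subst hij
      have hi : (i, b) ∈ u := hi
      have hj : (i, c) ∈ u := hj
      have := hu2 i
      cases b <;> cases c <;> first | rfl | tauto
    have hd : Disjoint (fullPairs s) (u.image Prod.fst) := by
      rw [Finset.disjoint_left]
      intro i hi hi'
      obtain ⟨⟨j, b⟩, hj, hij⟩ := Finset.mem_image.1 hi'
      have hij : j = i := hij
      subst hij
      rw [mem_fullPairs] at hi
      cases b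
      · exact (hsu hi.2).2 hj
      · exact (hsu hi.1).2 hj
    have h1 := Finset.card_le_univ (fullPairs s ∪ u.image Prod.fst)
    rw [Finset.card_union_of_disjoint hd, Finset.card_image_of_injOn hinj, huk,
      Fintype.card_fin] at h1
    omega
  · have h1 : k + 1 ≤ (fullPairs s)ᶜ.card := by
      rw [Finset.card_compl, Fintype.card_fin]
      omega
    obtain ⟨T, hT, hTk⟩ := Finset.exists_subset_card_eq h1
    have hb : ∀ i, ∃ b : Bool, i ∈ T → (i, b) ∉ s := by
      intro i
      by_cases hi : i ∈ T
      · have h2 := Finset.mem_compl.1 (hT hi)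
        rw [mem_fullPairs, not_and_or] at h2
        rcases h2 with h2 | h2
        · exact ⟨true, fun _ => h2⟩
        · exact ⟨false, fun _ => h2⟩
      · exact ⟨true, fun h => absurd h hi⟩
    choose b hb using hb
    have hmem : ∀ i c, (i, c) ∈ T.image (fun i => (i, b i)) ↔ i ∈ T ∧ b i = c := by
      intro i c
      simp only [Finset.mem_image, Prod.mk.injEq]
      constructor
      · rintro ⟨j, hj, rfl, rfl⟩
        exact ⟨hj, rfl⟩
      · rintro ⟨hi, rfl⟩
        exact ⟨i, hi, rfl, rfl⟩
    have hTn : T.Nonempty := Finset.card_pos.1 (by omega)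
    refine ⟨_, ⟨T.image (fun i => (i, b i)), ⟨hTn.image _, fun i hi => ?_⟩, ?_, rfl⟩, ?_⟩
    · rw [hmem, hmem] at hi
      exact Bool.noConfusion (hi.1.2.symm.trans hi.2.2)
    · rw [Finset.card_image_of_injective _ fun i j hij => congrArg Prod.fst hij, hTk]
    · rintro ⟨i, c⟩ hs
      refine ⟨⟨Finset.singleton_nonempty _, fun j hj => ?_⟩, fun hi => ?_⟩
      · simp only [Finset.mem_singleton] at hj
        exact Bool.noConfusion (congrArg Prod.snd (hj.1.trans hj.2.symm))
      · obtain ⟨hiT, rfl⟩ := (hmem i c).1 (Finset.mem_coe.1 hi)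
        exact hb i hiT hs

/-! ### Collapsing the non-critical simplices. -/

section CrossPoly

variable {n k : ℕ}

/-- The simplices attached last: they contain all `v_i^-` but not `v_0^+`, and as many antipodal
pairs as possible. -/
def IsCritical (n k : ℕ) (s : Finset (Fin (n + 1) × Bool)) : Prop :=
  (∀ i, (i, false) ∈ s) ∧ (0, true) ∉ s ∧ (fullPairs s).card + k = n

/-- The non-critical simplices of the theta complex of the cross-polytope. -/
def nonCritical (n k : ℕ) : PreAbstractSimplicialComplex (Fin (n + 1) × Bool) where
  faces := {s | s ∈ theta (CrossPoly (n + 1) k) ∧ ¬ IsCritical n k s}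
  isRelLowerSet_faces := by
    rintro s ⟨hs, h⟩
    refine ⟨nonempty_of_mem hs, fun t hts ht => ⟨mem_of_subset hs hts ht, fun hc => h ?_⟩⟩
    have h1 := fullPairs_mono hts
    have h2 := (mem_theta_CrossPoly.1 hs).2
    have h3 := Finset.card_le_card h1
    obtain ⟨hc1, hc2, hc3⟩ := hc
    -- A critical `t` already has the maximal number of pairs, so `s ⊇ t` has the same pairs and is
    -- critical too.
    have h4 : fullPairs t = fullPairs s := Finset.eq_of_subset_of_card_le h1 (by omega)
    refine ⟨fun i => hts (hc1 i), fun h0 => hc2 ?_, by rw [← h4, hc3]⟩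
    have h5 : (0 : Fin (n + 1)) ∈ fullPairs s := mem_fullPairs.2 ⟨h0, hts (hc1 0)⟩
    rw [← h4] at h5
    exact (mem_fullPairs.1 h5).1

theorem mem_nonCritical {s : Finset (Fin (n + 1) × Bool)} :
    s ∈ nonCritical n k ↔ s ∈ theta (CrossPoly (n + 1) k) ∧ ¬ IsCritical n k s := Iff.rfl

/-- The simplices which miss one of the first `j` vertices `v_i^-`. -/
def missing (n k j : ℕ) : PreAbstractSimplicialComplex (Fin (n + 1) × Bool) where
  faces := {s | s ∈ theta (CrossPoly (n + 1) k) ∧ ∃ i : Fin (n + 1), i.1 < j ∧ (i, false) ∉ s}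
  isRelLowerSet_faces := by
    rintro s ⟨hs, i, hi, h⟩
    exact ⟨nonempty_of_mem hs, fun t hts ht =>
      ⟨mem_of_subset hs hts ht, i, hi, fun h' => h (hts h')⟩⟩

theorem mem_missing {j : ℕ} {s : Finset (Fin (n + 1) × Bool)} :
    s ∈ missing n k j ↔ s ∈ theta (CrossPoly (n + 1) k) ∧
      ∃ i : Fin (n + 1), i.1 < j ∧ (i, false) ∉ s := Iff.rfl

theorem insert_mem_theta_CrossPoly {s : Finset (Fin n × Bool)} {i : Fin n}
    (hs : s ∈ theta (CrossPoly n k)) (hi : (i, false) ∉ s) :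
    insert (i, true) s ∈ theta (CrossPoly n k) := by
  rw [mem_theta_CrossPoly] at hs ⊢
  refine ⟨Finset.insert_nonempty _ _, ?_⟩
  have : fullPairs (insert (i, true) s) = fullPairs s := by
    ext j
    simp only [mem_fullPairs, Finset.mem_insert, Prod.mk.injEq, and_true, Bool.false_eq_true,
      and_false, false_or]
    constructor
    · rintro ⟨rfl | h, h'⟩
      · exact absurd h' hi
      · exact ⟨h, h'⟩
    · rintro ⟨h, h'⟩
      exact ⟨Or.inr h, h'⟩
  rw [this]
  exact hs.2

theorem contractibleSpace_missing_one (hk : k ≤ n) :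
    ContractibleSpace (realization (missing n k 1)) := by
  have h0 : ∀ s : Finset (Fin (n + 1) × Bool), s ∈ missing n k 1 ↔
      s ∈ theta (CrossPoly (n + 1) k) ∧ (0, false) ∉ s := by
    intro s
    rw [mem_missing]
    refine and_congr_right fun _ => ⟨?_, fun h => ⟨0, by simp, h⟩⟩
    rintro ⟨i, hi, h⟩
    have : i = 0 := Fin.ext (by simpa using hi)
    rwa [this] at h
  refine contractibleSpace_of_cone (0, true) ?_ ?_
  · rw [h0, mem_theta_CrossPoly]
    have : fullPairs {((0 : Fin (n + 1)), true)} = ∅ := by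
      ext j
      simp [mem_fullPairs]
    rw [this]
    refine ⟨⟨Finset.singleton_nonempty _, ?_⟩, by simp⟩
    simpa using hk
  · intro s hs
    rw [h0] at hs ⊢
    exact ⟨insert_mem_theta_CrossPoly hs.1 hs.2, by simpa using hs.2⟩

/-- The simplices missing `v_0^-` form a cone with apex `v_0^+`. Those whose first missing negative
vertex is `v_j^-` are paired by `v_j^+`, which creates no pair; `v_0^-` keeps the smaller partner
nonempty. -/
theorem contractibleSpace_missing (hk : k ≤ n) {j : ℕ} (hj : 1 ≤ j) (hjn : j ≤ n + 1) :
    ContractibleSpace (realization (missing n k j)) := by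
  induction j, hj using Nat.le_induction with
  | base => exact contractibleSpace_missing_one hk
  | succ j hj ih =>
    have := ih (by omega)
    let u : Fin (n + 1) := ⟨j, by omega⟩
    have hmiss : ∀ s ∈ missing n k (j + 1), s ∉ missing n k j → (u, false) ∉ s ∧
        ∀ i : Fin (n + 1), i.1 < j → (i, false) ∈ s := by
      intro s hs hs'
      rw [mem_missing] at hs hs'
      have h1 : ∀ i : Fin (n + 1), i.1 < j → (i, false) ∈ s := fun i hi => by
        by_contra h
        exact hs' ⟨hs.1, i, hi, h⟩
      obtain ⟨i, hi, h⟩ := hs.2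
      have h2 : i = u := Fin.ext (by
        have : ¬ i.1 < j := fun h' => h (h1 i h')
        change i.1 = j
        omega)
      exact ⟨h2 ▸ h, h1⟩
    refine contractibleSpace_of_toggle (L := missing n k j) ?_ (u, true) ?_ ?_
    · intro s hs
      obtain ⟨h1, i, hi, h⟩ := mem_missing.1 hs
      exact mem_missing.2 ⟨h1, i, by omega, h⟩
    · intro s hs hs'
      obtain ⟨h1, -⟩ := hmiss s hs hs'
      refine mem_missing.2 ⟨insert_mem_theta_CrossPoly (mem_missing.1 hs).1 h1, u, ?_, ?_⟩
      · exact Nat.lt_succ_self j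
      · simpa using h1
    · intro s hs hs'
      obtain ⟨-, h1⟩ := hmiss s hs hs'
      refine ⟨⟨(0, false), by simpa using h1 0 hj⟩, fun h => ?_⟩
      obtain ⟨-, i, hi, h2⟩ := mem_missing.1 h
      exact h2 (by simpa using h1 i hi)

/-- The simplices not yet reached contain every `v_i^-`. Adding `v_0^+` creates at most one pair,
and non-criticality says exactly that there is room for it. -/
theorem contractibleSpace_nonCritical (hk : k ≤ n) :
    ContractibleSpace (realization (nonCritical n k)) := by
  have := contractibleSpace_missing hk (Nat.le_add_left 1 n) le_rfl
  have hmiss : ∀ s ∈ nonCritical n k, s ∉ missing n k (n + 1) → ∀ i, (i, false) ∈ s := by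
    intro s hs hs' i
    by_contra h
    exact hs' (mem_missing.2 ⟨hs.1, i, i.2, h⟩)
  refine contractibleSpace_of_toggle (L := missing n k (n + 1)) ?_ (0, true) ?_ ?_
  · intro s hs
    obtain ⟨h1, i, -, h⟩ := mem_missing.1 hs
    exact mem_nonCritical.2 ⟨h1, fun hc => h (hc.1 i)⟩
  · intro s hs hs'
    have h1 := hmiss s hs hs'
    refine mem_nonCritical.2 ⟨mem_theta_CrossPoly.2 ⟨Finset.insert_nonempty _ _, ?_⟩,
      fun hc => hc.2.1 (Finset.mem_insert_self _ _)⟩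
    obtain ⟨h2, h3⟩ := mem_nonCritical.1 hs
    have h4 := (mem_theta_CrossPoly.1 h2).2
    by_cases h0 : ((0 : Fin (n + 1)), true) ∈ s
    · rwa [Finset.insert_eq_of_mem h0]
    · have h5 : (fullPairs s).card + k ≠ n := fun h => h3 ⟨h1, h0, h⟩
      have h6 : fullPairs (insert (0, true) s) ⊆ insert 0 (fullPairs s) := by
        intro i hi
        simp only [mem_fullPairs, Finset.mem_insert, Prod.mk.injEq, and_true] at hi ⊢
        rcases hi.1 with h | h
        · exact Or.inl h
        · exact Or.inr ⟨h, h1 i⟩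
      have h7 := (Finset.card_le_card h6).trans (Finset.card_insert_le _ _)
      omega
  · intro s hs hs'
    have h1 := hmiss s hs hs'
    refine ⟨⟨(0, false), by simpa using h1 0⟩, fun h => ?_⟩
    obtain ⟨-, i, -, h2⟩ := mem_missing.1 h
    exact h2 (by simpa using h1 i)

/-- The set of all `v_i^-` together with the `v_i^+` for `i ∈ T`. -/
def plusSet (T : Finset (Fin n)) : Finset (Fin n × Bool) :=
  Finset.univ.filter fun p => p.2 = true → p.1 ∈ T

theorem mem_plusSet_true {T : Finset (Fin n)} {i : Fin n} : (i, true) ∈ plusSet T ↔ i ∈ T := by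
  simp [plusSet]

theorem mem_plusSet_false {T : Finset (Fin n)} {i : Fin n} : (i, false) ∈ plusSet T := by
  simp [plusSet]

theorem fullPairs_plusSet (T : Finset (Fin n)) : fullPairs (plusSet T) = T := by
  ext i
  simp [mem_fullPairs, mem_plusSet_true, mem_plusSet_false]

theorem plusSet_fullPairs {s : Finset (Fin n × Bool)} (hs : ∀ i, (i, false) ∈ s) :
    plusSet (fullPairs s) = s := by
  ext ⟨i, b⟩
  cases b
  · simp [mem_plusSet_false, hs]
  · simp [mem_plusSet_true, mem_fullPairs, hs]

theorem card_plusSet (T : Finset (Fin n)) : (plusSet T).card = n + T.card := by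
  have : plusSet T = Finset.univ.image (fun i => (i, false)) ∪ T.image (fun i => (i, true)) := by
    ext ⟨i, b⟩
    cases b
    · simp [mem_plusSet_false]
    · simp [mem_plusSet_true]
  rw [this, Finset.card_union_of_disjoint, Finset.card_image_of_injective,
    Finset.card_image_of_injective, Finset.card_univ, Fintype.card_fin]
  · exact fun i j h => congrArg Prod.fst h
  · exact fun i j h => congrArg Prod.fst h
  · rw [Finset.disjoint_left]
    simp

theorem nonempty_homotopyEquiv_theta_CrossPoly (hk : k ≤ n) :
    Nonempty (realization (theta (CrossPoly (n + 1) k)) ≃ₕ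
      WedgeOfSpheres (n.choose k) (2 * (n + 1) - k - 2)) := by
  have := contractibleSpace_nonCritical hk
  have hT : ∀ s, s ∈ ((Finset.univ.erase (0 : Fin (n + 1))).powersetCard (n - k)).image plusSet ↔
      IsCritical n k s := by
    intro s
    simp only [Finset.mem_image, Finset.mem_powersetCard, Finset.subset_erase]
    constructor
    · rintro ⟨T, ⟨⟨-, hT0⟩, hT⟩, rfl⟩
      refine ⟨fun i => mem_plusSet_false, fun h => hT0 (mem_plusSet_true.1 h), ?_⟩
      rw [fullPairs_plusSet, hT]
      omega
    · rintro ⟨h1, h2, h3⟩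
      exact ⟨fullPairs s, ⟨⟨Finset.subset_univ _, fun h => h2 (mem_fullPairs.1 h).1⟩, by omega⟩,
        plusSet_fullPairs h1⟩
  have hS : ∀ s, s ∈ ((Finset.univ.erase (0 : Fin (n + 1))).powersetCard (n - k)).image plusSet ↔
      s ∈ theta (CrossPoly (n + 1) k) ∧ s ∉ nonCritical n k := by
    intro s
    rw [hT, mem_nonCritical]
    constructor
    · intro h
      refine ⟨mem_theta_CrossPoly.2 ⟨⟨_, h.1 0⟩, ?_⟩, fun h' => h'.2 h⟩
      have := h.2.2
      omega
    · rintro ⟨h1, h2⟩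
      by_contra h
      exact h2 ⟨h1, h⟩
  refine nonempty_homotopyEquiv_wedgeOfSpheres (A := nonCritical n k)
    (fun s hs => (mem_nonCritical.1 hs).1) _ hS ?_ ?_
  · intro s hs
    obtain ⟨T, hT, rfl⟩ := Finset.mem_image.1 hs
    rw [card_plusSet, (Finset.mem_powersetCard.1 hT).2]
    omega
  · rw [Finset.card_image_of_injective _ fun S T h => by
      rw [← fullPairs_plusSet S, h, fullPairs_plusSet],
      Finset.card_powersetCard, Finset.card_erase_of_mem (Finset.mem_univ _)]
    simpa using Nat.choose_symm hk

end CrossPoly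
end ThetaComplex

end

open ThetaComplex in
theorem mainTheorem7 (n k : ℕ) :
    (k < n → Nonempty (realization (theta (Simp n k)) ≃ₕ
      WedgeOfSpheres (n.choose (n - k)) (n - k - 1))) ∧
    (k = n → IsEmpty (realization (theta (Simp n k)))) ∧
    (k < n → Nonempty (realization (theta (CrossPoly n k)) ≃ₕ
      WedgeOfSpheres ((n - 1).choose k) (2 * n - k - 2))) := by
  refine ⟨nonempty_homotopyEquiv_theta_Simp, ?_, fun h => ?_⟩
  · rintro rfl
    exact isEmpty_theta_Simp k
  -- The cross-polytope result is stated for `n + 1` so that the vertices `v_0^±` exist; `k < n`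
  -- rules out `n = 0`.
  · obtain ⟨m, rfl⟩ := Nat.exists_eq_succ_of_ne_zero (Nat.ne_of_gt (Nat.zero_lt_of_lt h))
    exact nonempty_homotopyEquiv_theta_CrossPoly (Nat.le_of_lt_succ h)
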